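/- Let $p,q,\theta$ be real numbers with $0<\theta\le p<\min\{1,q\}$. Let $\mathcal M^+$ be the set of Lebesgue measurable functions $(0,\infty)\to[0,\infty]$. Let $u,v\in\mathcal M^+$, and let $w\in\mathcal M^+$ be a weight, that is, $0<w<\infty$ a.e. on $(0,\infty)$, such that $\int_t^\infty w<\infty$ for all $t\in(0,\infty)$. The convention $0\cdot\infty=0$ is used. Consider the inequality $$\bigg(\int_0^\infty\bigg(\int_0^t f(s)^p v(s)\,ds\bigg)^{\frac qp}u(t)\,dt\bigg)^{\frac1q}\le C\bigg(\int_0^\infty\bigg(\int_0^t f(s)\,ds\bigg)^{\theta}w(t)\,dt\bigg)^{\frac1\theta}.\qquad(*)$$ Its best constant is the infimum of all $C\in[0,\infty)$ for which $(*)$ holds for all $f\in\mathcal M^+$ (and $\infty$ if there is no such $C$). (i) If $1\le q<\infty$, then $(*)$ holds for all $f\in\mathcal M^+$ with some finite constant $C$ if and only if $$A_1:=\sup_{x\in(0,\infty)}\bigg(\int_x^\infty w\bigg)^{-\frac1\theta}\sup_{t\in(x,\infty)}\bigg(\int_x^t v^{\frac1{1-p}}\bigg)^{\frac{1-p}p}\bigg(\int_t^\infty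 u\bigg)^{\frac1q}<\infty .$$ Moreover, there are constants $c_1,c_2\in(0,\infty)$ depending only on $p,q,\theta$ (not on $u,v,w$) such that the best constant $C$ in $(*)$ satisfies $c_1A_1\le C\le c_2A_1$. (ii) If $q<1$, then $(*)$ holds for all $f\in\mathcal M^+$ with some finite constant $C$ if and only if $$A_2:=\sup_{x\in(0,\infty)}\bigg(\int_x^\infty w\bigg)^{-\frac1\theta}\bigg(\int_x^\infty\bigg(\int_x^t v^{\frac1{1-p}}\bigg)^{\frac{q(1-p)}{p(1-q)}}\bigg(\int_t^\infty u\bigg)^{\frac q{1-q}}u(t)\,dt\bigg)^{\frac{1-q}q}<\infty .$$ Moreover, there are constants $c_1,c_2\in(0,\infty)$ depending only on $p,q,\theta$ (not on $u,v,w$) such that the best constant $C$ in $(*)$ satisfies $c_1A_2\le C\le c_2A_2$. -/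

import Mathlib

open MeasureTheory Set
open scoped ENNReal NNReal

namespace CesaroEmbedding

/-- `𝓜⁺`: Lebesgue measurable functions on `(0, ∞)` with values in `[0, ∞]`. Functions are
represented on `ℝ`, but only their values on `(0, ∞)` matter. -/
def MPlus (f : ℝ → ℝ≥0∞) : Prop :=
  AEMeasurable f (volume.restrict (Ioi 0))

/-- `𝓦`: weights, i.e. measurable functions that are positive and finite a.e. on `(0, ∞)`. -/
def IsWeight (w : ℝ → ℝ≥0∞) : Prop :=
  MPlus w ∧ ∀ᵐ t ∂(volume.restrict (Ioi (0 : ℝ))), 0 < w t ∧ w t < ∞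

/-- The standing assumptions on the triple `(u, v, w)`. -/
structure Admissible (u v w : ℝ → ℝ≥0∞) : Prop where
  u_mem : MPlus u
  v_mem : MPlus v
  w_weight : IsWeight w
  w_tail : ∀ t : ℝ, 0 < t → ∫⁻ s in Ioi t, w s < ∞

/-- `(∫₀^∞ (∫₀ᵗ f(s)ᵖ v(s) ds)^{q/p} u(t) dt)^{1/q}`. -/
noncomputable def cesaro (p q : ℝ) (u v f : ℝ → ℝ≥0∞) : ℝ≥0∞ :=
  (∫⁻ t in Ioi (0 : ℝ), (∫⁻ s in Ioo 0 t, f s ^ p * v s) ^ (q / p) * u t) ^ (1 / q)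

/-- The inequality
`(∫₀^∞ (∫₀ᵗ fᵖ v)^{q/p} u(t) dt)^{1/q} ≤ C (∫₀^∞ (∫₀ᵗ f)^θ w(t) dt)^{1/θ}`
for all `f ∈ 𝓜⁺`, with the finite constant `C`. -/
def HoldsWith (p q θ : ℝ) (u v w : ℝ → ℝ≥0∞) (C : ℝ≥0) : Prop :=
  ∀ f : ℝ → ℝ≥0∞, MPlus f →
    cesaro p q u v f
      ≤ (C : ℝ≥0∞) * (∫⁻ t in Ioi (0 : ℝ), (∫⁻ s in Ioo 0 t, f s) ^ θ * w t) ^ (1 / θ)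

/-- The best constant: the infimum of all finite admissible constants (`∞` if there is none). -/
noncomputable def bestConstant (p q θ : ℝ) (u v w : ℝ → ℝ≥0∞) : ℝ≥0∞ :=
  ⨅ (C : ℝ≥0) (_ : HoldsWith p q θ u v w C), (C : ℝ≥0∞)

/-- `A₁ = sup_{x > 0} (∫ₓ^∞ w)^{-1/θ}
  sup_{t > x} (∫ₓᵗ v^{1/(1-p)})^{(1-p)/p} (∫ₜ^∞ u)^{1/q}`. -/
noncomputable def A₁ (p q θ : ℝ) (u v w : ℝ → ℝ≥0∞) : ℝ≥0∞ :=
  ⨆ x ∈ Ioi (0 : ℝ), (∫⁻ s in Ioi x, w s) ^ (-(1 / θ)) *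
    ⨆ t ∈ Ioi x, (∫⁻ s in Ioo x t, v s ^ (1 / (1 - p))) ^ ((1 - p) / p) *
      (∫⁻ s in Ioi t, u s) ^ (1 / q)

/-- `A₂ = sup_{x > 0} (∫ₓ^∞ w)^{-1/θ}
  (∫ₓ^∞ (∫ₓᵗ v^{1/(1-p)})^{q(1-p)/(p(1-q))} (∫ₜ^∞ u)^{q/(1-q)} u(t) dt)^{(1-q)/q}`. -/
noncomputable def A₂ (p q θ : ℝ) (u v w : ℝ → ℝ≥0∞) : ℝ≥0∞ :=
  ⨆ x ∈ Ioi (0 : ℝ), (∫⁻ s in Ioi x, w s) ^ (-(1 / θ)) *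
    (∫⁻ t in Ioi x,
      (∫⁻ s in Ioo x t, v s ^ (1 / (1 - p))) ^ (q * (1 - p) / (p * (1 - q))) *
        (∫⁻ s in Ioi t, u s) ^ (q / (1 - q)) * u t) ^ ((1 - q) / q)

end CesaroEmbedding

/-!
Write `W(x) = ∫ₓ^∞ w`, `F(t) = ∫₀ᵗ f`, and let `K(x)` be the best constant in the Hardy inequality
`(∫ₓ^∞ (∫ₓᵗ fᵖ v)^{q/p} u(t) dt)^{1/q} ≤ K(x) ∫ₓ^∞ f` on the half-line `(x, ∞)`, an inequality from
`L^{1/p}` to `L^{q/p}` for `fᵖ`. The best constant of the embedding is equivalent to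
`sup_x W(x)^{-1/θ} K(x)` (`bestConstant_equiv`), and `A₁`, `A₂` arise from the classical
two-weight characterizations of `K(x)` for `1 ≤ q` and for `q < 1`.

Necessity is immediate: for `f` supported in `(x, ∞)` the right-hand side of the embedding is at most
`W(x)^{1/θ} ∫ₓ^∞ f` (`hardyNorm_le_of_holdsWith`). For sufficiency (`cesaro_le_of_hardy`), cut `f`
along the sets `{2ᵏ ≤ F < 2ᵏ⁺¹}`. The piece number `k` has mass at most `2ᵏ⁺¹` and lives on
`[x_k, ∞)`, where `x_k` is the first point with `F = 2ᵏ`. Minkowski's inequality in `L^{q/p}(u)` and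
`θ ≤ p` bound the `p`-th power of the left-hand side by a multiple of
`∑ₖ (2ᵏ W(x_k)^{1/θ})ᵖ ≤ (∑ₖ 2^{kθ} W(x_k))^{p/θ}`, and the last sum is at most a multiple of
`∫ F^θ w` since `2^{kθ}` is summed over `2ᵏ ≤ F(t)`, a geometric series.

Hardy's inequality itself is proved by the same dyadic device applied to `G(t) = ∫ₓᵗ fᵖ v`: the
growth of `G` from `2ᵏ⁻¹` to `2ᵏ` is controlled by Hölder's inequality on the preceding shell
(`two_zpow_rpow_le_of_dyadicShell`). Its sharpness is seen on explicit extremal functions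
(`hardyConst₁_le`, `hardyConst₂_le`). Integration by parts is replaced throughout by cutting an
atomless measure into two halves (`exists_half_split`), which costs only constants and works for
measures of infinite mass.
-/

namespace CesaroEmbedding

/-! ### Distribution functions of atomless measures on the line -/

theorem exists_lt_measure_Iio (ν : Measure ℝ) {c : ℝ≥0∞} {t : ℝ} (h : c < ν (Iio t)) :
    ∃ s < t, c < ν (Iio s) := by
  obtain ⟨a, ha, hat, hlim⟩ := exists_seq_strictMono_tendsto t
  have hU : Iio t = ⋃ n, Iio (a n) := by
    ext y
    simp only [mem_Iio, mem_iUnion]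
    exact ⟨fun hy => (hlim.eventually (lt_mem_nhds hy)).exists, fun ⟨n, hn⟩ => hn.trans (hat n)⟩
  have hm : Monotone fun n => Iio (a n) := fun i j hij => Iio_subset_Iio (ha.monotone hij)
  rw [hU, hm.measure_iUnion, lt_iSup_iff] at h
  obtain ⟨n, hn⟩ := h
  exact ⟨a n, hat n, hn⟩

theorem exists_lt_measure_Ioi (ν : Measure ℝ) {c : ℝ≥0∞} {t : ℝ} (h : c < ν (Ioi t)) :
    ∃ s > t, c < ν (Ioi s) := by
  obtain ⟨a, ha, hat, hlim⟩ := exists_seq_strictAnti_tendsto t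
  have hU : Ioi t = ⋃ n, Ioi (a n) := by
    ext y
    simp only [mem_Ioi, mem_iUnion]
    exact ⟨fun hy => (hlim.eventually (gt_mem_nhds hy)).exists, fun ⟨n, hn⟩ => (hat n).trans hn⟩
  have hm : Monotone fun n => Ioi (a n) := fun i j hij => Ioi_subset_Ioi (ha.antitone hij)
  rw [hU, hm.measure_iUnion, lt_iSup_iff] at h
  obtain ⟨n, hn⟩ := h
  exact ⟨a n, hat n, hn⟩

theorem exists_lt_measure_Iio_of_lt_univ (ν : Measure ℝ) {c : ℝ≥0∞} (h : c < ν univ) :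
    ∃ s, c < ν (Iio s) := by
  have hm : Monotone fun n : ℕ => Iio (n : ℝ) := fun i j hij => Iio_subset_Iio (by exact_mod_cast hij)
  have hU : (univ : Set ℝ) = ⋃ n : ℕ, Iio (n : ℝ) := by
    ext y
    simpa using exists_nat_gt y
  rw [hU, hm.measure_iUnion, lt_iSup_iff] at h
  obtain ⟨n, hn⟩ := h
  exact ⟨n, hn⟩

theorem exists_lt_measure_Ioi_of_lt_univ (ν : Measure ℝ) {c : ℝ≥0∞} (h : c < ν univ) :
    ∃ s, c < ν (Ioi s) := by
  have hm : Monotone fun n : ℕ => Ioi (-(n : ℝ)) :=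
    fun i j hij => Ioi_subset_Ioi (by simpa using hij)
  have hU : (univ : Set ℝ) = ⋃ n : ℕ, Ioi (-(n : ℝ)) := by
    ext y
    obtain ⟨n, hn⟩ := exists_nat_gt (-y)
    simpa using ⟨n, by linarith⟩
  rw [hU, hm.measure_iUnion, lt_iSup_iff] at h
  obtain ⟨n, hn⟩ := h
  exact ⟨-n, hn⟩

/-- An atomless measure, finite or not, can be cut at a point so that both sides carry at least
(almost) half of the mass. The two sets of points where the left, respectively the right, side
is heavy are open and cover the line, so they meet because the line is connected. -/
theorem exists_half_split (ν : Measure ℝ) [NullSingletonClass ν] {c : ℝ≥0∞} (h : c < ν univ) :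
    ∃ t, c / 2 < ν (Iio t) ∧ c / 2 < ν (Ioi t) := by
  have hc : c / 2 < ν univ := ENNReal.half_le_self.trans_lt h
  have hA : IsOpen {t | c / 2 < ν (Iio t)} := by
    rw [isOpen_iff_mem_nhds]
    intro t ht
    obtain ⟨s, hs, hcs⟩ := exists_lt_measure_Iio ν ht
    filter_upwards [Ioi_mem_nhds hs] with r hr
    exact lt_of_lt_of_le hcs (measure_mono (Iio_subset_Iio (le_of_lt hr)))
  have hB : IsOpen {t | c / 2 < ν (Ioi t)} := by
    rw [isOpen_iff_mem_nhds]
    intro t ht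
    obtain ⟨s, hs, hcs⟩ := exists_lt_measure_Ioi ν ht
    filter_upwards [Iio_mem_nhds hs] with r hr
    exact lt_of_lt_of_le hcs (measure_mono (Ioi_subset_Ioi (le_of_lt hr)))
  have hcov : {t | c / 2 < ν (Iio t)} ∪ {t | c / 2 < ν (Ioi t)} = univ := by
    ext t
    simp only [mem_union, mem_ofPred_eq, mem_univ, iff_true]
    by_contra! hcon
    have h1 : ν univ ≤ ν (Iio t) + ν (Ici t) :=
      (measure_mono (by intro y _; exact lt_or_ge y t)).trans (measure_union_le _ _)
    rw [← measure_congr (Ioi_ae_eq_Ici (μ := ν) (a := t))] at h1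
    have h2 := h1.trans (add_le_add hcon.1 hcon.2)
    rw [ENNReal.add_halves] at h2
    exact absurd h (not_lt.2 h2)
  obtain ⟨t, -, h1, h2⟩ := isPreconnected_univ (α := ℝ) _ _ hA hB hcov.ge
    (by rw [univ_inter]; exact exists_lt_measure_Iio_of_lt_univ ν hc)
    (by rw [univ_inter]; exact exists_lt_measure_Ioi_of_lt_univ ν hc)
  exact ⟨t, h1, h2⟩

theorem rpow_le_of_forall_lt {m D : ℝ≥0∞} {e : ℝ} (he : 0 < e)
    (h : ∀ c < m, (c / 2) ^ e ≤ D) : m ^ e ≤ 2 ^ e * D := by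
  have h2 : (2 : ℝ≥0∞) ≠ 0 := by norm_num
  have key : m ≤ (2 ^ e * D) ^ e⁻¹ := by
    refine le_of_forall_lt_imp_le_of_dense fun c hc => ?_
    rw [ENNReal.le_rpow_inv_iff he]
    calc c ^ e = (2 * (c / 2)) ^ e := by rw [ENNReal.mul_div_cancel h2 (by norm_num)]
      _ = 2 ^ e * (c / 2) ^ e := ENNReal.mul_rpow_of_nonneg _ _ he.le
      _ ≤ _ := by gcongr; exact h c hc
  rwa [ENNReal.le_rpow_inv_iff he] at key

/-- Replaces the identity `μ(ℝ) ^ (s + 1) = (s + 1) ∫ μ(t, ∞) ^ s dμ(t)`; no finiteness of `μ` is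
needed. -/
theorem measure_univ_rpow_le_lintegral_Ioi (ν : Measure ℝ) [NullSingletonClass ν] {s : ℝ} (hs : 0 ≤ s) :
    ν univ ^ (s + 1) ≤ 2 ^ (s + 1) * ∫⁻ t, ν (Ioi t) ^ s ∂ν := by
  refine rpow_le_of_forall_lt (by linarith) fun c hc => ?_
  obtain ⟨t, h1, h2⟩ := exists_half_split ν hc
  calc (c / 2) ^ (s + 1) = (c / 2) ^ s * (c / 2) := by
        rw [ENNReal.rpow_add_of_nonneg _ _ hs zero_le_one, ENNReal.rpow_one]
    _ ≤ ν (Ioi t) ^ s * ν (Iio t) := by gcongr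
    _ = ∫⁻ _ in Iio t, ν (Ioi t) ^ s ∂ν := by rw [setLIntegral_const]
    _ ≤ ∫⁻ r in Iio t, ν (Ioi r) ^ s ∂ν :=
        setLIntegral_mono' measurableSet_Iio fun r hr => by
          have : Ioi t ⊆ Ioi r := Ioi_subset_Ioi (le_of_lt hr)
          gcongr
    _ ≤ _ := setLIntegral_le_lintegral _ _

theorem measure_univ_rpow_le_lintegral_Iio (ν : Measure ℝ) [NullSingletonClass ν] {s : ℝ} (hs : 0 ≤ s) :
    ν univ ^ (s + 1) ≤ 2 ^ (s + 1) * ∫⁻ t, ν (Iio t) ^ s ∂ν := by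
  refine rpow_le_of_forall_lt (by linarith) fun c hc => ?_
  obtain ⟨t, h1, h2⟩ := exists_half_split ν hc
  calc (c / 2) ^ (s + 1) = (c / 2) ^ s * (c / 2) := by
        rw [ENNReal.rpow_add_of_nonneg _ _ hs zero_le_one, ENNReal.rpow_one]
    _ ≤ ν (Iio t) ^ s * ν (Ioi t) := by gcongr
    _ = ∫⁻ _ in Ioi t, ν (Iio t) ^ s ∂ν := by rw [setLIntegral_const]
    _ ≤ ∫⁻ r in Ioi t, ν (Iio r) ^ s ∂ν :=
        setLIntegral_mono' measurableSet_Ioi fun r hr => by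
          have : Iio t ⊆ Iio r := Iio_subset_Iio (le_of_lt hr)
          gcongr
    _ ≤ _ := setLIntegral_le_lintegral _ _

/-- The mass of a sublevel set of the distribution function of `ν`; with `c = 0` it says that the set
where the distribution function vanishes is null. -/
theorem measure_setOf_measure_Iio_le (ν : Measure ℝ) [NullSingletonClass ν] (c : ℝ≥0∞) :
    ν {t | ν (Iio t) ≤ c} ≤ c := by
  by_contra! hcon
  by_cases hb : BddAbove {t | ν (Iio t) ≤ c}
  · set m := sSup {t | ν (Iio t) ≤ c}
    have h1 : ν {t | ν (Iio t) ≤ c} ≤ ν (Iio m) :=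
      (measure_mono fun t ht => le_csSup hb ht).trans_eq (measure_congr Iio_ae_eq_Iic).symm
    obtain ⟨s, hs, hcs⟩ := exists_lt_measure_Iio ν (hcon.trans_le h1)
    have hne : {t | ν (Iio t) ≤ c}.Nonempty := by
      by_contra hne
      rw [not_nonempty_iff_eq_empty] at hne
      simp [hne] at hcon
    obtain ⟨r, hr, hsr⟩ := exists_lt_of_lt_csSup hne hs
    exact absurd hr (not_le.2 (hcs.trans_le (measure_mono (Iio_subset_Iio hsr.le))))
  · obtain ⟨s, hs⟩ := exists_lt_measure_Iio_of_lt_univ ν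
      (hcon.trans_le (measure_mono (subset_univ _)))
    rw [not_bddAbove_iff] at hb
    obtain ⟨r, hr, hsr⟩ := hb s
    exact absurd hr (not_le.2 (hs.trans_le (measure_mono (Iio_subset_Iio hsr.le))))

/-- The first point `b` at which the distribution function of `ν` reaches the level `c`. -/
theorem exists_level (ν : Measure ℝ) [NullSingletonClass ν] {c : ℝ≥0∞} {t₀ : ℝ} (hc : 0 < c)
    (h0 : c ≤ ν (Iio t₀)) (hfin : ∀ t, ν (Iio t) < ∞) :
    ∃ b, (∀ t, ν (Iio t) < c → t < b) ∧ (∀ t, c ≤ ν (Iio t) → b ≤ t) ∧ ν (Iio b) = c := by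
  have hub : ∀ t, c ≤ ν (Iio t) → t ∈ upperBounds {s | ν (Iio s) < c} := by
    intro t ht s hs
    by_contra! hlt
    exact absurd (ht.trans (measure_mono (Iio_subset_Iio hlt.le))) (not_le.2 hs)
  have hne : {s | ν (Iio s) < c}.Nonempty := by
    have h := tendsto_measure_iInter_atTop (μ := ν) (s := fun n : ℕ => Iio (-(n : ℝ)))
      (fun _ => measurableSet_Iio.nullMeasurableSet)
      (fun i j hij => Iio_subset_Iio (by simpa using hij)) ⟨0, (hfin _).ne⟩
    have he : (⋂ n : ℕ, Iio (-(n : ℝ))) = ∅ := by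
      ext y
      obtain ⟨n, hn⟩ := exists_nat_gt (-y)
      simpa using ⟨n, by linarith⟩
    rw [he, measure_empty] at h
    obtain ⟨n, hn⟩ := (h.eventually (gt_mem_nhds hc)).exists
    exact ⟨_, hn⟩
  have hbdd : BddAbove {s | ν (Iio s) < c} := ⟨t₀, hub t₀ h0⟩
  set b := sSup {s | ν (Iio s) < c} with hb
  have hbc : ν (Iio b) = c := by
    apply le_antisymm
    · by_contra! hcon
      obtain ⟨s, hs, hcs⟩ := exists_lt_measure_Iio ν hcon
      obtain ⟨r, hr, hsr⟩ := exists_lt_of_lt_csSup hne hs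
      exact absurd (hcs.trans_le (measure_mono (Iio_subset_Iio hsr.le))) (not_lt.2 (le_of_lt hr))
    · obtain ⟨a, ha, hab, hlim⟩ := exists_seq_strictAnti_tendsto b
      have h := tendsto_measure_iInter_atTop (μ := ν) (s := fun n : ℕ => Iio (a n))
        (fun _ => measurableSet_Iio.nullMeasurableSet)
        (fun i j hij => Iio_subset_Iio (ha.antitone hij)) ⟨0, (hfin _).ne⟩
      have h2 : (⋂ n, Iio (a n)) ⊆ Iic b := by
        intro y hy
        simp only [mem_iInter, mem_Iio] at hy
        exact ge_of_tendsto' hlim fun n => (hy n).le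
      have h3 : c ≤ ν (⋂ n, Iio (a n)) := by
        refine ge_of_tendsto' h fun n => ?_
        by_contra! hcon
        exact absurd (le_csSup hbdd hcon) (not_le.2 (hab n))
      exact (h3.trans (measure_mono h2)).trans_eq (measure_congr Iio_ae_eq_Iic).symm
  refine ⟨b, fun t ht => ?_, fun t ht => csSup_le hne (hub t ht), hbc⟩
  refine lt_of_le_of_ne (le_csSup hbdd ht) ?_
  rintro rfl
  exact absurd hbc ht.ne

/-! ### Series of extended nonnegative reals -/

theorem tsum_rpow_le_rpow_tsum {ι : Type*} (y : ι → ℝ≥0∞) {r : ℝ} (hr : 1 ≤ r) :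
    ∑' i, y i ^ r ≤ (∑' i, y i) ^ r := by
  have e : ∀ z : ℝ≥0∞, z ^ r = z * z ^ (r - 1) := fun z => by
    conv_lhs => rw [show r = 1 + (r - 1) by ring]
    rw [ENNReal.rpow_add_of_nonneg _ _ zero_le_one (by linarith), ENNReal.rpow_one]
  rw [e (∑' i, y i), ← ENNReal.tsum_mul_right]
  refine ENNReal.tsum_le_tsum fun i => ?_
  rw [e]
  have := ENNReal.le_tsum (f := y) i
  have h : 0 ≤ r - 1 := by linarith
  gcongr

/-- Hölder's inequality for series. -/
theorem tsum_rpow_mul_rpow_le (y z : ℤ → ℝ≥0∞) {a b : ℝ} (ha : 0 ≤ a) (hb : 0 ≤ b)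
    (hab : a + b = 1) :
    ∑' k, y k ^ a * z k ^ b ≤ (∑' k, y k) ^ a * (∑' k, z k) ^ b := by
  simpa [lintegral_count] using ENNReal.lintegral_mul_norm_pow_le (μ := Measure.count) (f := y) (g := z)
    (Measurable.of_discrete).aemeasurable (Measurable.of_discrete).aemeasurable ha hb hab

/-- Minkowski's inequality for series in `L^r`, `r ≥ 1`. -/
theorem lintegral_tsum_rpow_le {α : Type*} [MeasurableSpace α] (μ : Measure α) {r : ℝ}
    (hr : 1 ≤ r) (g : ℤ → α → ℝ≥0∞) (hg : ∀ k, Measurable (g k)) :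
    (∫⁻ a, (∑' k, g k a) ^ r ∂μ) ^ (1 / r) ≤ ∑' k, (∫⁻ a, g k a ^ r ∂μ) ^ (1 / r) := by
  have hr0 : 0 < r := by linarith
  have hfin : ∀ s : Finset ℤ, (∫⁻ a, (∑ k ∈ s, g k a) ^ r ∂μ) ^ (1 / r)
      ≤ ∑ k ∈ s, (∫⁻ a, g k a ^ r ∂μ) ^ (1 / r) := by
    intro s
    induction s using Finset.induction_on with
    | empty => simp [hr0]
    | insert k s hk ih =>
      simp only [Finset.sum_insert hk]
      refine le_trans ?_ (add_le_add le_rfl ih)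
      exact ENNReal.lintegral_Lp_add_le (hg k).aemeasurable
        (Finset.measurable_fun_sum s fun i _ => hg i).aemeasurable hr
  let e : ℕ → Finset ℤ := fun n => Finset.Icc (-n) n
  have he : Monotone e := fun i j hij =>
    Finset.Icc_subset_Icc (by simpa using hij) (by simpa using hij)
  have hsup : ∀ a, ∑' k, g k a = ⨆ n, ∑ k ∈ e n, g k a := fun a => by
    refine ENNReal.tsum_eq_iSup_sum' _ fun t => ?_
    obtain ⟨n, hn⟩ := (t.image Int.natAbs).exists_nat_subset_range
    refine ⟨n, fun k hk => ?_⟩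
    have := Finset.mem_range.1 (hn (Finset.mem_image_of_mem _ hk))
    simp only [e, Finset.mem_Icc]
    omega
  have hrpow : ∀ a, (∑' k, g k a) ^ r = ⨆ n, (∑ k ∈ e n, g k a) ^ r := fun a => by
    rw [hsup]
    exact (ENNReal.orderIsoRpow r hr0).map_iSup fun n => ∑ k ∈ e n, g k a
  rw [one_div, ENNReal.rpow_inv_le_iff hr0]
  simp only [hrpow]
  rw [lintegral_iSup (fun n => (Finset.measurable_fun_sum _ fun i _ => hg i).pow_const r)]
  · refine iSup_le fun n => ?_
    rw [← ENNReal.rpow_inv_le_iff hr0]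
    have := (hfin (e n)).trans (ENNReal.sum_le_tsum (f := fun k => (∫⁻ a, g k a ^ r ∂μ) ^ (1 / r)) _)
    simpa only [one_div] using this
  · intro i j hij a
    have : ∑ k ∈ e i, g k a ≤ ∑ k ∈ e j, g k a := Finset.sum_le_sum_of_subset (he hij)
    simp only
    gcongr

theorem tsum_dyadic_rpow_le {θ : ℝ} (hθ : 0 < θ) (y : ℝ≥0∞) :
    ∑' k : ℤ, (if (2 : ℝ≥0∞) ^ k ≤ y then ((2 : ℝ≥0∞) ^ k) ^ θ else 0)
      ≤ (1 - (2 : ℝ≥0∞) ^ (-θ))⁻¹ * y ^ θ := by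
  have hpos : ∀ k : ℤ, (2 : ℝ≥0∞) ^ k ≠ 0 := fun k => (ENNReal.zpow_pos (by norm_num) (by norm_num) k).ne'
  rcases eq_or_ne y 0 with rfl | h0
  · simp [hpos]
  rcases eq_or_ne y ∞ with rfl | htop
  · have : (1 - (2 : ℝ≥0∞) ^ (-θ))⁻¹ ≠ 0 :=
      ENNReal.inv_ne_zero.2 (ne_top_of_le_ne_top ENNReal.one_ne_top tsub_le_self)
    rw [ENNReal.top_rpow_of_pos hθ, ENNReal.mul_top this]
    exact le_top
  obtain ⟨n, hn1, hn2⟩ := ENNReal.exists_mem_Ico_zpow h0 htop (y := 2) (by norm_num) (by norm_num)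
  have hinj : Function.Injective fun j : ℕ => n - (j : ℤ) := fun i j hij => by
    simp only at hij
    omega
  rw [← hinj.tsum_eq]
  · calc ∑' j : ℕ, (if (2 : ℝ≥0∞) ^ (n - (j : ℤ)) ≤ y then ((2 : ℝ≥0∞) ^ (n - (j : ℤ))) ^ θ else 0)
        ≤ ∑' j : ℕ, ((2 : ℝ≥0∞) ^ (-θ)) ^ j * y ^ θ := by
          refine ENNReal.tsum_le_tsum fun j => ?_
          split_ifs with h
          · rw [sub_eq_add_neg, ENNReal.zpow_add (by norm_num) (by norm_num),
              ENNReal.mul_rpow_of_nonneg _ _ hθ.le, mul_comm]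
            refine mul_le_mul' (le_of_eq ?_) (ENNReal.rpow_le_rpow hn1 hθ.le)
            rw [← ENNReal.rpow_intCast, ← ENNReal.rpow_natCast, ← ENNReal.rpow_mul,
              ← ENNReal.rpow_mul]
            congr 1
            push_cast
            ring
          · exact zero_le
      _ = _ := by rw [ENNReal.tsum_mul_right, ENNReal.tsum_geometric]
  · intro k hk
    have hk' : (2 : ℝ≥0∞) ^ k ≤ y := by
      by_contra hcon
      simp [hcon] at hk
    have : k < n + 1 := by
      by_contra! hcon
      exact absurd (hk'.trans_lt hn2) (not_lt.2 (ENNReal.zpow_le_of_le (by norm_num) hcon))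
    exact ⟨(n - k).toNat, by simp only; omega⟩

/-! ### Dyadic shells and monotone convergence -/

/-- The set where `G` lies in the dyadic interval `[2 ^ k, 2 ^ (k + 1))`. -/
def dyadicShell (G : ℝ → ℝ≥0∞) (k : ℤ) : Set ℝ := G ⁻¹' Ico (2 ^ k) (2 ^ (k + 1))

theorem two_zpow_pos (k : ℤ) : 0 < (2 : ℝ≥0∞) ^ k := ENNReal.zpow_pos (by norm_num) (by norm_num) k

theorem two_zpow_lt_top (k : ℤ) : (2 : ℝ≥0∞) ^ k < ∞ :=
  ENNReal.zpow_lt_top (by norm_num) (by norm_num) k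

theorem two_zpow_add_one (k : ℤ) : (2 : ℝ≥0∞) ^ (k + 1) = 2 * 2 ^ k := by
  rw [ENNReal.zpow_add (by norm_num) (by norm_num), zpow_one, mul_comm]

theorem monotone_setLIntegral_Ioo (g : ℝ → ℝ≥0∞) (x : ℝ) :
    Monotone fun t => ∫⁻ s in Ioo x t, g s :=
  fun _ _ h => lintegral_mono_set (Ioo_subset_Ioo_right h)

theorem measurable_setLIntegral_Ioo (g : ℝ → ℝ≥0∞) (x : ℝ) :
    Measurable fun t => ∫⁻ s in Ioo x t, g s :=
  (monotone_setLIntegral_Ioo g x).measurable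

theorem antitone_setLIntegral_Ioi (g : ℝ → ℝ≥0∞) : Antitone fun t => ∫⁻ s in Ioi t, g s :=
  fun _ _ h => lintegral_mono_set (Ioi_subset_Ioi h)

theorem measurable_setLIntegral_Ioi (g : ℝ → ℝ≥0∞) : Measurable fun t => ∫⁻ s in Ioi t, g s :=
  (antitone_setLIntegral_Ioi g).measurable

theorem measurableSet_dyadicShell {G : ℝ → ℝ≥0∞} (hG : Measurable G) (k : ℤ) :
    MeasurableSet (dyadicShell G k) := hG measurableSet_Ico

theorem pairwise_disjoint_dyadicShell (G : ℝ → ℝ≥0∞) :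
    Pairwise (Function.onFun Disjoint (dyadicShell G)) := by
  have hm : Monotone fun k : ℤ => (2 : ℝ≥0∞) ^ k :=
    fun i j hij => ENNReal.zpow_le_of_le (by norm_num) hij
  exact fun i j hij => (hm.pairwise_disjoint_on_Ico_succ hij).preimage G

theorem dyadicShell_subset_Ioi (g : ℝ → ℝ≥0∞) (x : ℝ) (k : ℤ) :
    dyadicShell (fun t => ∫⁻ s in Ioo x t, g s) k ⊆ Ioi x := by
  intro t ht
  by_contra hcon
  have : Ioo x t = ∅ := Ioo_eq_empty hcon
  have h := ht.1
  simp only [this, Measure.restrict_empty, lintegral_zero_measure] at h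
  exact absurd (two_zpow_pos k) (not_lt.2 h)

theorem tsum_setLIntegral_dyadicShell_le {G : ℝ → ℝ≥0∞} (hG : Measurable G) {s : Set ℝ}
    (hs : ∀ k, dyadicShell G k ⊆ s) (f : ℝ → ℝ≥0∞) :
    ∑' k, ∫⁻ t in dyadicShell G k, f t ≤ ∫⁻ t in s, f t := by
  rw [← lintegral_iUnion (measurableSet_dyadicShell hG) (pairwise_disjoint_dyadicShell G)]
  exact lintegral_mono_set (iUnion_subset hs)

theorem iSup_rpow_mul_iSup {a b : ℕ → ℝ≥0∞} (ha : Monotone a) (hb : Monotone b) {r : ℝ}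
    (hr : 0 < r) : (⨆ n, a n) ^ r * ⨆ n, b n = ⨆ n, a n ^ r * b n := by
  have e : (⨆ n, a n) ^ r = ⨆ n, a n ^ r := (ENNReal.orderIsoRpow r hr).map_iSup a
  rw [e]
  refine le_antisymm ?_ ENNReal.iSup_mul_le
  rw [ENNReal.iSup_mul]
  refine iSup_le fun i => ?_
  rw [ENNReal.mul_iSup]
  refine iSup_le fun j => le_iSup_of_le (max i j) ?_
  gcongr
  · exact ha (le_max_left i j)
  · exact hb (le_max_right i j)

/-- Monotone convergence for iterated Hardy-type integrals. -/
theorem setLIntegral_iSup_le {x r : ℝ} (hr : 0 < r) {g h : ℕ → ℝ → ℝ≥0∞}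
    (hg : Monotone g) (hgm : ∀ n, Measurable (g n)) (hh : Monotone h)
    (hhm : ∀ n, Measurable (h n)) {D : ℝ≥0∞}
    (hD : ∀ n, ∫⁻ t in Ioi x, (∫⁻ s in Ioo x t, g n s) ^ r * h n t ≤ D) :
    ∫⁻ t in Ioi x, (∫⁻ s in Ioo x t, ⨆ n, g n s) ^ r * (⨆ n, h n t) ≤ D := by
  have e : ∀ t, (∫⁻ s in Ioo x t, ⨆ n, g n s) ^ r * (⨆ n, h n t)
      = ⨆ n, (∫⁻ s in Ioo x t, g n s) ^ r * h n t := fun t => by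
    rw [lintegral_iSup hgm hg]
    exact iSup_rpow_mul_iSup (fun i j hij => lintegral_mono (hg hij)) (fun i j hij => hh hij t) hr
  simp only [e]
  have hm : ∀ n, Measurable fun t => (∫⁻ s in Ioo x t, g n s) ^ r * h n t :=
    fun n => ((measurable_setLIntegral_Ioo _ _).pow_const r).mul (hhm n)
  rw [lintegral_iSup hm]
  · exact iSup_le hD
  · intro i j hij t
    simp only
    gcongr
    · exact hg hij _
    · exact hh hij _

/-- The truncations `min v n` of `v`. -/
noncomputable def trunc (v : ℝ → ℝ≥0∞) (n : ℕ) (s : ℝ) : ℝ≥0∞ := v s ⊓ n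

theorem monotone_trunc (v : ℝ → ℝ≥0∞) : Monotone (trunc v) :=
  fun i j hij s => inf_le_inf_left _ (by exact_mod_cast hij)

theorem measurable_trunc {v : ℝ → ℝ≥0∞} (hv : Measurable v) (n : ℕ) : Measurable (trunc v n) :=
  hv.inf measurable_const

theorem trunc_le (v : ℝ → ℝ≥0∞) (n : ℕ) (s : ℝ) : trunc v n s ≤ v s := inf_le_left

theorem trunc_le_natCast (v : ℝ → ℝ≥0∞) (n : ℕ) (s : ℝ) : trunc v n s ≤ n := inf_le_right

theorem iSup_trunc (v : ℝ → ℝ≥0∞) (s : ℝ) : ⨆ n, trunc v n s = v s := by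
  simp only [trunc]
  rw [← inf_iSup_eq, ENNReal.iSup_natCast, inf_top_eq]

theorem iSup_trunc_rpow (v : ℝ → ℝ≥0∞) {r : ℝ} (hr : 0 < r) (s : ℝ) :
    ⨆ n, trunc v n s ^ r = v s ^ r := by
  rw [← iSup_trunc v s]
  exact ((ENNReal.orderIsoRpow r hr).map_iSup _).symm

/-! ### Hardy's inequality on a half-line: sufficiency -/

/-- The left-hand side of the weighted Hardy inequality on `(x, ∞)`; for `x = 0` it is
`cesaro`. -/
noncomputable def hardyNorm (p q : ℝ) (u v : ℝ → ℝ≥0∞) (x : ℝ) (f : ℝ → ℝ≥0∞) : ℝ≥0∞ :=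
  (∫⁻ t in Ioi x, (∫⁻ s in Ioo x t, f s ^ p * v s) ^ (q / p) * u t) ^ (1 / q)

/-- The constant of the Hardy inequality on `(x, ∞)` for `1 ≤ q`. -/
noncomputable def hardyConst₁ (p q : ℝ) (u v : ℝ → ℝ≥0∞) (x : ℝ) : ℝ≥0∞ :=
  ⨆ t ∈ Ioi x, (∫⁻ s in Ioo x t, v s ^ (1 / (1 - p))) ^ ((1 - p) / p) *
      (∫⁻ s in Ioi t, u s) ^ (1 / q)

/-- The constant of the Hardy inequality on `(x, ∞)` for `q < 1`. -/
noncomputable def hardyConst₂ (p q : ℝ) (u v : ℝ → ℝ≥0∞) (x : ℝ) : ℝ≥0∞ :=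
  (∫⁻ t in Ioi x,
      (∫⁻ s in Ioo x t, v s ^ (1 / (1 - p))) ^ (q * (1 - p) / (p * (1 - q))) *
        (∫⁻ s in Ioi t, u s) ^ (q / (1 - q)) * u t) ^ ((1 - q) / q)

/-- Hölder's inequality with the exponents `1 / p` and `1 / (1 - p)`. -/
theorem setLIntegral_rpow_mul_le {f v : ℝ → ℝ≥0∞} (hf : Measurable f) (hv : Measurable v)
    {p : ℝ} (hp0 : 0 < p) (hp1 : p < 1) (S : Set ℝ) :
    ∫⁻ s in S, f s ^ p * v s ≤ (∫⁻ s in S, f s) ^ p * (∫⁻ s in S, v s ^ (1 / (1 - p))) ^ (1 - p) := by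
  have h1 : 0 < 1 - p := by linarith
  have := ENNReal.lintegral_mul_norm_pow_le (μ := volume.restrict S) hf.aemeasurable
    (hv.pow_const (1 / (1 - p))).aemeasurable hp0.le h1.le (by ring)
  simpa only [← ENNReal.rpow_mul, one_div_mul_cancel h1.ne', ENNReal.rpow_one] using this

/-- The mass of the primitive `G` gained between the levels `2 ^ (k - 1)` and `2 ^ k` is
comparable with `2 ^ (k + 1)`; by Hölder it is controlled by the mass of `f` on the shell
`k - 1`. Here `b` is the first point where `G` reaches `2 ^ k`. -/
theorem two_zpow_rpow_le_of_dyadicShell {f v : ℝ → ℝ≥0∞} (hf : Measurable f) (hv : Measurable v)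
    {p q : ℝ} (hp0 : 0 < p) (hp1 : p < 1) (hq0 : 0 < q) {x : ℝ} {G : ℝ → ℝ≥0∞}
    (hG : G = fun t => ∫⁻ s in Ioo x t, f s ^ p * v s) (hfin : ∀ t, G t < ∞) {k : ℤ}
    (hk : (dyadicShell G k).Nonempty) :
    ∃ b, x < b ∧ dyadicShell G k ⊆ Ici b ∧
      ((2 : ℝ≥0∞) ^ (k + 1)) ^ (q / p) ≤ 4 ^ (q / p) * ((∫⁻ s in dyadicShell G (k - 1), f s) ^ q *
        (∫⁻ s in Ioo x b, v s ^ (1 / (1 - p))) ^ (q * (1 - p) / p)) := by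
  set ν := (volume.restrict (Ioi x)).withDensity fun s => f s ^ p * v s with hν
  have hνI : ∀ t, ν (Iio t) = G t := fun t => by
    rw [hν, withDensity_apply _ measurableSet_Iio, Measure.restrict_restrict measurableSet_Iio,
      inter_comm, Ioi_inter_Iio, hG]
  have hmono : Monotone G := by rw [hG]; exact monotone_setLIntegral_Ioo _ x
  have hgt : ∀ t, 0 < G t → x < t := by
    intro t ht
    by_contra hcon
    rw [hG] at ht
    simp [Ioo_eq_empty hcon] at ht
  obtain ⟨t₀, ht₀⟩ := hk
  have hstep : (2 : ℝ≥0∞) ^ k = 2 * 2 ^ (k - 1) := by rw [← two_zpow_add_one]; ring_nf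
  obtain ⟨b, hb1, hb2, hb3⟩ := exists_level ν (two_zpow_pos k) (by rw [hνI]; exact ht₀.1)
    (fun t => by rw [hνI]; exact hfin t)
  have hle : (2 : ℝ≥0∞) ^ (k - 1) ≤ 2 ^ k := ENNReal.zpow_le_of_le (by norm_num) (by omega)
  obtain ⟨a, ha1, ha2, ha3⟩ := exists_level ν (two_zpow_pos (k - 1)) (t₀ := b)
    (by rw [hb3]; exact hle) (fun t => by rw [hνI]; exact hfin t)
  simp only [hνI] at hb1 hb2 hb3 ha1 ha2 ha3
  have hxa : x < a := hgt a (by rw [ha3]; exact two_zpow_pos _)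
  have hab : a ≤ b := ha2 b (by rw [hb3]; exact hle)
  have hsub : Ico a b ⊆ dyadicShell G (k - 1) := by
    intro t ht
    refine ⟨ha3.ge.trans (hmono ht.1), ?_⟩
    rw [sub_add_cancel]
    by_contra! hcon
    exact absurd (hb2 t hcon) (not_le.2 ht.2)
  have hmass : (2 : ℝ≥0∞) ^ (k - 1) ≤ ν (Ico a b) := by
    have h1 : ν (Iio b) ≤ ν (Iio a) + ν (Ico a b) := by
      rw [← Iio_union_Ico_eq_Iio hab]
      exact measure_union_le _ _
    rw [hνI, hνI, hb3, ha3, hstep, two_mul] at h1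
    exact (ENNReal.add_le_add_iff_left (two_zpow_lt_top _).ne).1 h1
  refine ⟨b, hxa.trans_le hab, fun t ht => hb2 t ht.1, ?_⟩
  have hmass2 : (2 : ℝ≥0∞) ^ (k - 1) ≤ (∫⁻ s in dyadicShell G (k - 1), f s) ^ p *
      (∫⁻ s in Ioo x b, v s ^ (1 / (1 - p))) ^ (1 - p) := by
    have h1 : 0 ≤ 1 - p := by linarith
    refine hmass.trans ?_
    rw [hν, withDensity_apply _ measurableSet_Ico, Measure.restrict_restrict measurableSet_Ico,
      inter_eq_left.2 (show Ico a b ⊆ Ioi x from fun t ht => hxa.trans_le ht.1)]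
    refine (setLIntegral_rpow_mul_le hf hv hp0 hp1 _).trans ?_
    have hsub2 : Ico a b ⊆ Ioo x b := fun t ht => ⟨hxa.trans_le ht.1, ht.2⟩
    have := lintegral_mono_set (μ := volume) (f := f) hsub
    have := lintegral_mono_set (μ := volume) (f := fun s => v s ^ (1 / (1 - p))) hsub2
    gcongr
  have hr : 0 ≤ q / p := by positivity
  calc ((2 : ℝ≥0∞) ^ (k + 1)) ^ (q / p) = (4 * 2 ^ (k - 1)) ^ (q / p) := by
        rw [two_zpow_add_one, hstep, ← mul_assoc]
        norm_num
    _ = 4 ^ (q / p) * ((2 : ℝ≥0∞) ^ (k - 1)) ^ (q / p) := ENNReal.mul_rpow_of_nonneg _ _ hr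
    _ ≤ _ := by
        gcongr
        refine (ENNReal.rpow_le_rpow hmass2 hr).trans_eq ?_
        rw [ENNReal.mul_rpow_of_nonneg _ _ hr, ← ENNReal.rpow_mul, ← ENNReal.rpow_mul,
          mul_div_cancel₀ _ hp0.ne']
        congr 2
        ring

theorem setLIntegral_rpow_mul_le_tsum {G u : ℝ → ℝ≥0∞} (hG : Measurable G) (hu : Measurable u)
    (hfin : ∀ t, G t < ∞) {r : ℝ} (hr : 0 < r) (S : Set ℝ) :
    ∫⁻ t in S, G t ^ r * u t
      ≤ ∑' k : ℤ, ((2 : ℝ≥0∞) ^ (k + 1)) ^ r * ∫⁻ t in dyadicShell G k, u t := by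
  calc ∫⁻ t in S, G t ^ r * u t
      ≤ ∫⁻ t, ∑' k : ℤ, (dyadicShell G k).indicator
          (fun t => ((2 : ℝ≥0∞) ^ (k + 1)) ^ r * u t) t := by
        refine (setLIntegral_le_lintegral _ _).trans (lintegral_mono fun t => ?_)
        rcases eq_or_ne (G t) 0 with h0 | h0
        · simp [h0, hr]
        obtain ⟨k, hk⟩ := ENNReal.exists_mem_Ico_zpow h0 (hfin t).ne (y := 2) (by norm_num)
          (by norm_num)
        have hk' : t ∈ dyadicShell G k := hk
        refine le_trans ?_ (ENNReal.le_tsum k)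
        rw [indicator_of_mem hk']
        have := hk.2.le
        gcongr
    _ = _ := by
        rw [lintegral_tsum fun k =>
          ((hu.const_mul _).indicator (measurableSet_dyadicShell hG k)).aemeasurable]
        congr 1 with k
        rw [lintegral_indicator (measurableSet_dyadicShell hG k), lintegral_const_mul _ hu]

theorem tsum_dyadicShell_sub_one_le {G : ℝ → ℝ≥0∞} (hG : Measurable G) {s : Set ℝ}
    (hs : ∀ k, dyadicShell G k ⊆ s) (f : ℝ → ℝ≥0∞) :
    ∑' k, ∫⁻ t in dyadicShell G (k - 1), f t ≤ ∫⁻ t in s, f t :=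
  ((Equiv.subRight (1 : ℤ)).tsum_eq fun k => ∫⁻ t in dyadicShell G k, f t).trans_le
    (tsum_setLIntegral_dyadicShell_le hG hs f)

/-- For `1 ≤ q` the shell estimates add up because `∑ yₖ ^ q ≤ (∑ yₖ) ^ q`. -/
theorem hardy_of_finite_of_one_le {f u v : ℝ → ℝ≥0∞} (hf : Measurable f) (hu : Measurable u)
    (hv : Measurable v) {p q : ℝ} (hp0 : 0 < p) (hp1 : p < 1) (hq : 1 ≤ q) {x : ℝ}
    (hfin : ∀ t, ∫⁻ s in Ioo x t, f s ^ p * v s < ∞) :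
    ∫⁻ t in Ioi x, (∫⁻ s in Ioo x t, f s ^ p * v s) ^ (q / p) * u t
      ≤ 4 ^ (q / p) * (hardyConst₁ p q u v x * ∫⁻ s in Ioi x, f s) ^ q := by
  have hq0 : 0 < q := by linarith
  have hr : 0 < q / p := by positivity
  set G := fun t => ∫⁻ s in Ioo x t, f s ^ p * v s with hG
  have hGm : Measurable G := measurable_setLIntegral_Ioo _ _
  refine (setLIntegral_rpow_mul_le_tsum hGm hu hfin hr _).trans ?_
  calc ∑' k : ℤ, ((2 : ℝ≥0∞) ^ (k + 1)) ^ (q / p) * ∫⁻ t in dyadicShell G k, u t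
      ≤ ∑' k : ℤ, 4 ^ (q / p) * hardyConst₁ p q u v x ^ q *
          (∫⁻ s in dyadicShell G (k - 1), f s) ^ q := by
        refine ENNReal.tsum_le_tsum fun k => ?_
        rcases (dyadicShell G k).eq_empty_or_nonempty with he | hne
        · simp [he]
        obtain ⟨b, hxb, hb, hle⟩ := two_zpow_rpow_le_of_dyadicShell hf hv hp0 hp1 hq0 hG hfin hne
        have hu' : ∫⁻ t in dyadicShell G k, u t ≤ ∫⁻ t in Ioi b, u t :=
          (lintegral_mono_set hb).trans_eq (setLIntegral_congr Ioi_ae_eq_Ici.symm)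
        have hB : (∫⁻ s in Ioo x b, v s ^ (1 / (1 - p))) ^ (q * (1 - p) / p) *
            ∫⁻ t in Ioi b, u t ≤ hardyConst₁ p q u v x ^ q := by
          have : (∫⁻ s in Ioo x b, v s ^ (1 / (1 - p))) ^ ((1 - p) / p) *
              (∫⁻ s in Ioi b, u s) ^ (1 / q) ≤ hardyConst₁ p q u v x :=
            le_iSup₂_of_le b hxb le_rfl
          refine le_trans (le_of_eq ?_) (ENNReal.rpow_le_rpow this hq0.le)
          rw [ENNReal.mul_rpow_of_nonneg _ _ hq0.le, ← ENNReal.rpow_mul, ← ENNReal.rpow_mul,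
            one_div_mul_cancel hq0.ne', ENNReal.rpow_one]
          congr 2
          ring
        calc _ ≤ 4 ^ (q / p) * ((∫⁻ s in dyadicShell G (k - 1), f s) ^ q *
                (∫⁻ s in Ioo x b, v s ^ (1 / (1 - p))) ^ (q * (1 - p) / p)) *
                ∫⁻ t in Ioi b, u t := by gcongr
          _ = 4 ^ (q / p) * (((∫⁻ s in Ioo x b, v s ^ (1 / (1 - p))) ^ (q * (1 - p) / p) *
                ∫⁻ t in Ioi b, u t)) * (∫⁻ s in dyadicShell G (k - 1), f s) ^ q := by ring
          _ ≤ _ := by gcongr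
    _ ≤ 4 ^ (q / p) * hardyConst₁ p q u v x ^ q * (∫⁻ s in Ioi x, f s) ^ q := by
        rw [ENNReal.tsum_mul_left]
        gcongr
        refine (tsum_rpow_le_rpow_tsum _ hq).trans ?_
        gcongr
        exact tsum_dyadicShell_sub_one_le hGm (dyadicShell_subset_Ioi _ x) f
    _ = _ := by rw [ENNReal.mul_rpow_of_nonneg _ _ hq0.le, mul_assoc]

theorem setLIntegral_rpow_le_setLIntegral_Ioi {u : ℝ → ℝ≥0∞} (hu : Measurable u) {S : Set ℝ}
    {b : ℝ} (hb : 0 ≤ b) :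
    (∫⁻ t in S, u t) ^ (b + 1)
      ≤ 2 ^ (b + 1) * ∫⁻ t in S, (∫⁻ s in Ioi t ∩ S, u s) ^ b * u t := by
  have h := measure_univ_rpow_le_lintegral_Ioi ((volume.restrict S).withDensity u) hb
  have hI : ∀ t, (volume.restrict S).withDensity u (Ioi t) = ∫⁻ s in Ioi t ∩ S, u s := fun t => by
    rw [withDensity_apply _ measurableSet_Ioi, Measure.restrict_restrict measurableSet_Ioi]
  have hanti : Antitone fun t => ∫⁻ s in Ioi t ∩ S, u s := fun i j hij =>
    lintegral_mono_set (inter_subset_inter_left _ (Ioi_subset_Ioi hij))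
  rw [withDensity_apply _ MeasurableSet.univ, Measure.restrict_univ] at h
  simp only [hI] at h
  rw [lintegral_withDensity_eq_lintegral_mul _ hu (hanti.measurable.pow_const b)] at h
  simpa only [Pi.mul_apply, mul_comm (u _)] using h

theorem setLIntegral_rpow_le_setLIntegral_Iio {u : ℝ → ℝ≥0∞} (hu : Measurable u) {S : Set ℝ}
    {b : ℝ} (hb : 0 ≤ b) :
    (∫⁻ t in S, u t) ^ (b + 1)
      ≤ 2 ^ (b + 1) * ∫⁻ t in S, (∫⁻ s in Iio t ∩ S, u s) ^ b * u t := by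
  have h := measure_univ_rpow_le_lintegral_Iio ((volume.restrict S).withDensity u) hb
  have hI : ∀ t, (volume.restrict S).withDensity u (Iio t) = ∫⁻ s in Iio t ∩ S, u s := fun t => by
    rw [withDensity_apply _ measurableSet_Iio, Measure.restrict_restrict measurableSet_Iio]
  have hmono : Monotone fun t => ∫⁻ s in Iio t ∩ S, u s := fun i j hij =>
    lintegral_mono_set (inter_subset_inter_left _ (Iio_subset_Iio hij))
  rw [withDensity_apply _ MeasurableSet.univ, Measure.restrict_univ] at h
  simp only [hI] at h
  rw [lintegral_withDensity_eq_lintegral_mul _ hu (hmono.measurable.pow_const b)] at h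
  simpa only [Pi.mul_apply, mul_comm (u _)] using h

/-- For `q < 1` the shell estimates are added up by Hölder's inequality with the exponents `1 / q` and
`1 / (1 - q)`; the second factor is recognized as `hardyConst₂` by splitting `u` on each shell. -/
theorem hardy_of_finite_of_lt_one {f u v : ℝ → ℝ≥0∞} (hf : Measurable f) (hu : Measurable u)
    (hv : Measurable v) {p q : ℝ} (hp0 : 0 < p) (hp1 : p < 1) (hq0 : 0 < q) (hq : q < 1) {x : ℝ}
    (hfin : ∀ t, ∫⁻ s in Ioo x t, f s ^ p * v s < ∞) :
    ∫⁻ t in Ioi x, (∫⁻ s in Ioo x t, f s ^ p * v s) ^ (q / p) * u t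
      ≤ 2 * 4 ^ (q / p) * (hardyConst₂ p q u v x * ∫⁻ s in Ioi x, f s) ^ q := by
  have hr : 0 < q / p := by positivity
  have hq1 : 0 < 1 - q := by linarith
  have hp1' : 0 < 1 - p := by linarith
  set G := fun t => ∫⁻ s in Ioo x t, f s ^ p * v s with hG
  have hGm : Measurable G := measurable_setLIntegral_Ioo _ _
  refine (setLIntegral_rpow_mul_le_tsum hGm hu hfin hr _).trans ?_
  set a := q * (1 - p) / (p * (1 - q)) with ha
  have ha0 : 0 ≤ a := by positivity
  set b' := q / (1 - q) with hb'
  have hb0 : 0 ≤ b' := by positivity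
  have hb1 : b' + 1 = 1 / (1 - q) := by rw [hb']; field_simp; ring
  set Φ : ℝ → ℝ≥0∞ := fun t => (∫⁻ s in Ioo x t, v s ^ (1 / (1 - p))) ^ a *
        (∫⁻ s in Ioi t, u s) ^ b' * u t with hΦ
  calc ∑' k : ℤ, ((2 : ℝ≥0∞) ^ (k + 1)) ^ (q / p) * ∫⁻ t in dyadicShell G k, u t
      ≤ ∑' k : ℤ, 2 * 4 ^ (q / p) * ((∫⁻ s in dyadicShell G (k - 1), f s) ^ q *
          (∫⁻ t in dyadicShell G k, Φ t) ^ (1 - q)) := by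
        refine ENNReal.tsum_le_tsum fun k => ?_
        rcases (dyadicShell G k).eq_empty_or_nonempty with he | hne
        · simp [he]
        obtain ⟨b, hxb, hb, hle⟩ := two_zpow_rpow_le_of_dyadicShell hf hv hp0 hp1 hq0 hG hfin hne
        have hS : MeasurableSet (dyadicShell G k) := measurableSet_dyadicShell hGm k
        have hJ : (∫⁻ s in Ioo x b, v s ^ (1 / (1 - p))) ^ a *
            (∫⁻ t in dyadicShell G k, u t) ^ (b' + 1)
            ≤ 2 ^ (b' + 1) * ∫⁻ t in dyadicShell G k, Φ t := by
          calc _ ≤ (∫⁻ s in Ioo x b, v s ^ (1 / (1 - p))) ^ a * (2 ^ (b' + 1) *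
                ∫⁻ t in dyadicShell G k, (∫⁻ s in Ioi t, u s) ^ b' * u t) := by
                gcongr
                refine (setLIntegral_rpow_le_setLIntegral_Ioi hu hb0).trans ?_
                gcongr
                exact inter_subset_left
            _ = 2 ^ (b' + 1) * ∫⁻ t in dyadicShell G k,
                (∫⁻ s in Ioo x b, v s ^ (1 / (1 - p))) ^ a * ((∫⁻ s in Ioi t, u s) ^ b' * u t) := by
                have hm : Measurable fun t => (∫⁻ s in Ioi t, u s) ^ b' * u t :=
                  ((measurable_setLIntegral_Ioi u).pow_const b').mul hu
                rw [lintegral_const_mul _ hm]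
                ring
            _ ≤ _ := by
                gcongr 2 ^ (b' + 1) * ?_
                refine setLIntegral_mono' hS fun t ht => ?_
                simp only [hΦ, mul_assoc]
                gcongr
                exact hb ht
        have hJ2 := ENNReal.rpow_le_rpow hJ hq1.le
        rw [ENNReal.mul_rpow_of_nonneg _ _ hq1.le, ENNReal.mul_rpow_of_nonneg _ _ hq1.le,
          ← ENNReal.rpow_mul, ← ENNReal.rpow_mul, ← ENNReal.rpow_mul, hb1,
          one_div_mul_cancel hq1.ne', ENNReal.rpow_one, ENNReal.rpow_one,
          show a * (1 - q) = q * (1 - p) / p by rw [ha]; field_simp] at hJ2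
        calc _ ≤ 4 ^ (q / p) * ((∫⁻ s in dyadicShell G (k - 1), f s) ^ q *
                (∫⁻ s in Ioo x b, v s ^ (1 / (1 - p))) ^ (q * (1 - p) / p)) *
                ∫⁻ t in dyadicShell G k, u t := by gcongr
          _ = 4 ^ (q / p) * (∫⁻ s in dyadicShell G (k - 1), f s) ^ q *
              (((∫⁻ s in Ioo x b, v s ^ (1 / (1 - p))) ^ (q * (1 - p) / p) *
                ∫⁻ t in dyadicShell G k, u t)) := by ring
          _ ≤ 4 ^ (q / p) * (∫⁻ s in dyadicShell G (k - 1), f s) ^ q *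
              (2 * (∫⁻ t in dyadicShell G k, Φ t) ^ (1 - q)) := by gcongr
          _ = _ := by ring
    _ ≤ 2 * 4 ^ (q / p) * ((∫⁻ s in Ioi x, f s) ^ q * (∫⁻ t in Ioi x, Φ t) ^ (1 - q)) := by
        rw [ENNReal.tsum_mul_left]
        gcongr 2 * 4 ^ (q / p) * ?_
        refine (tsum_rpow_mul_rpow_le _ _ hq0.le hq1.le (by ring)).trans ?_
        gcongr
        · exact tsum_dyadicShell_sub_one_le hGm (dyadicShell_subset_Ioi _ x) f
        · exact tsum_setLIntegral_dyadicShell_le hGm (dyadicShell_subset_Ioi _ x) Φ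
    _ = _ := by
        rw [ENNReal.mul_rpow_of_nonneg _ _ hq0.le, hardyConst₂, ← ENNReal.rpow_mul,
          div_mul_cancel₀ _ hq0.ne', mul_comm (_ ^ q)]

/-- Truncating `v` makes the primitives of `f ^ p * v` finite. -/
theorem setLIntegral_rpow_mul_trunc_lt_top {f : ℝ → ℝ≥0∞} (v : ℝ → ℝ≥0∞) {p : ℝ}
    (hp0 : 0 < p) (hp1 : p < 1) {x : ℝ} (hf1 : ∫⁻ s in Ioi x, f s < ∞) (n : ℕ) (t : ℝ) :
    ∫⁻ s in Ioo x t, f s ^ p * trunc v n s < ∞ := by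
  calc ∫⁻ s in Ioo x t, f s ^ p * trunc v n s ≤ ∫⁻ s in Ioo x t, (1 + f s) * n := by
        refine lintegral_mono fun s => mul_le_mul' ?_ (trunc_le_natCast v n s)
        rcases le_total (f s) 1 with h | h
        · exact (ENNReal.rpow_le_one h hp0.le).trans le_self_add
        · refine (ENNReal.rpow_le_rpow_of_exponent_le h hp1.le).trans ?_
          rw [ENNReal.rpow_one]
          exact le_add_self
    _ = (volume (Ioo x t) + ∫⁻ s in Ioo x t, f s) * n := by
        rw [lintegral_mul_const' _ _ (ENNReal.natCast_ne_top n), lintegral_add_left measurable_const,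
          setLIntegral_const, one_mul]
    _ < ∞ := by
        refine ENNReal.mul_lt_top (ENNReal.add_lt_top.2 ⟨by simp, ?_⟩) (by simp)
        exact (lintegral_mono_set Ioo_subset_Ioi_self).trans_lt hf1

/-- The finiteness of the primitives can be dropped by truncating `v`. -/
theorem hardy_of_trunc {f u v : ℝ → ℝ≥0∞} (hf : Measurable f) (hu : Measurable u)
    (hv : Measurable v) {p q : ℝ} (hp0 : 0 < p) (hq0 : 0 < q) {x : ℝ} {D : ℝ≥0∞}
    (h : ∀ n, ∫⁻ t in Ioi x, (∫⁻ s in Ioo x t, f s ^ p * trunc v n s) ^ (q / p) * u t ≤ D) :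
    ∫⁻ t in Ioi x, (∫⁻ s in Ioo x t, f s ^ p * v s) ^ (q / p) * u t ≤ D := by
  have := setLIntegral_iSup_le (x := x) (r := q / p) (by positivity)
    (g := fun n s => f s ^ p * trunc v n s) (h := fun _ t => u t)
    (fun i j hij s => by
      simp only
      gcongr
      exact monotone_trunc v hij s)
    (fun n => (hf.pow_const p).mul (measurable_trunc hv n)) monotone_const (fun _ => hu) h
  simpa only [← ENNReal.mul_iSup, iSup_trunc, iSup_const] using this

theorem hardyNorm_le_hardyConst₁ {f u v : ℝ → ℝ≥0∞} (hf : Measurable f) (hu : Measurable u)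
    (hv : Measurable v) {p q : ℝ} (hp0 : 0 < p) (hp1 : p < 1) (hq : 1 ≤ q) {x : ℝ}
    (hf1 : ∫⁻ s in Ioi x, f s < ∞) :
    hardyNorm p q u v x f
      ≤ (2 * 4 ^ (q / p)) ^ (1 / q) * (hardyConst₁ p q u v x * ∫⁻ s in Ioi x, f s) := by
  have hq0 : 0 < q := by linarith
  have h1 : 0 ≤ 1 - p := by linarith
  rw [hardyNorm, one_div, ENNReal.rpow_inv_le_iff hq0, ENNReal.mul_rpow_of_nonneg _ _ hq0.le,
    ← ENNReal.rpow_mul, inv_mul_cancel₀ hq0.ne', ENNReal.rpow_one]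
  refine hardy_of_trunc hf hu hv hp0 hq0 fun n => ?_
  refine (hardy_of_finite_of_one_le hf hu (measurable_trunc hv n) hp0 hp1 hq
    (setLIntegral_rpow_mul_trunc_lt_top v hp0 hp1 hf1 n)).trans ?_
  have hK : hardyConst₁ p q u (trunc v n) x ≤ hardyConst₁ p q u v x := by
    unfold hardyConst₁
    gcongr
    exact trunc_le v n _
  have : (4 : ℝ≥0∞) ^ (q / p) ≤ 2 * 4 ^ (q / p) := le_mul_of_one_le_left' (by norm_num)
  gcongr

theorem hardyNorm_le_hardyConst₂ {f u v : ℝ → ℝ≥0∞} (hf : Measurable f) (hu : Measurable u)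
    (hv : Measurable v) {p q : ℝ} (hp0 : 0 < p) (hp1 : p < 1) (hq0 : 0 < q) (hq : q < 1) {x : ℝ}
    (hf1 : ∫⁻ s in Ioi x, f s < ∞) :
    hardyNorm p q u v x f
      ≤ (2 * 4 ^ (q / p)) ^ (1 / q) * (hardyConst₂ p q u v x * ∫⁻ s in Ioi x, f s) := by
  have h1 : 0 < 1 - p := by linarith
  have h2 : 0 < 1 - q := by linarith
  rw [hardyNorm, one_div, ENNReal.rpow_inv_le_iff hq0, ENNReal.mul_rpow_of_nonneg _ _ hq0.le,
    ← ENNReal.rpow_mul, inv_mul_cancel₀ hq0.ne', ENNReal.rpow_one]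
  refine hardy_of_trunc hf hu hv hp0 hq0 fun n => ?_
  refine (hardy_of_finite_of_lt_one hf hu (measurable_trunc hv n) hp0 hp1 hq0 hq
    (setLIntegral_rpow_mul_trunc_lt_top v hp0 hp1 hf1 n)).trans ?_
  have hK : hardyConst₂ p q u (trunc v n) x ≤ hardyConst₂ p q u v x := by
    unfold hardyConst₂
    gcongr
    exact trunc_le v n _
  gcongr

/-! ### Hardy's inequality on a half-line: necessity -/

theorem rpow_mul_le_of_rpow_add_one_mul_le {m y D : ℝ≥0∞} {e : ℝ} (he : 0 < e) (hm : m ≠ ∞)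
    (h : m ^ (e + 1) * y ≤ D * m) : m ^ e * y ≤ D := by
  rcases eq_or_ne m 0 with rfl | h0
  · simp [ENNReal.zero_rpow_of_pos he]
  rw [ENNReal.rpow_add_of_nonneg _ _ he.le zero_le_one, ENNReal.rpow_one, mul_right_comm] at h
  exact (ENNReal.mul_le_mul_iff_left h0 hm).1 h

theorem rpow_one_div_one_sub (z : ℝ≥0∞) {p : ℝ} (hp0 : 0 < p) (hp1 : p < 1) :
    (z ^ (1 / (1 - p))) ^ p * z = z ^ (1 / (1 - p)) := by
  have h1 : 0 < 1 - p := by linarith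
  have h : z ^ (1 / (1 - p)) = z ^ (1 / (1 - p) * p + 1) := by
    congr 1
    field_simp
    ring
  rw [← ENNReal.rpow_mul]
  conv_rhs => rw [h]
  rw [ENNReal.rpow_add_of_nonneg _ _ (by positivity) zero_le_one, ENNReal.rpow_one]

theorem hardyNorm_mono {p q : ℝ} (hp0 : 0 < p) (hq0 : 0 < q) {u u' v v' : ℝ → ℝ≥0∞}
    (hu : ∀ t, u t ≤ u' t) (hv : ∀ t, v t ≤ v' t) (x : ℝ) (f : ℝ → ℝ≥0∞) :
    hardyNorm p q u v x f ≤ hardyNorm p q u' v' x f := by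
  unfold hardyNorm
  gcongr
  · exact hv _
  · exact hu _

theorem setLIntegral_trunc_rpow_lt_top (v : ℝ → ℝ≥0∞) {r : ℝ} (hr : 0 ≤ r) (n : ℕ) (x t : ℝ) :
    ∫⁻ s in Ioo x t, trunc v n s ^ r < ∞ := by
  calc ∫⁻ s in Ioo x t, trunc v n s ^ r ≤ ∫⁻ s in Ioo x t, (n : ℝ≥0∞) ^ r :=
        lintegral_mono fun s => ENNReal.rpow_le_rpow (trunc_le_natCast v n s) hr
    _ < ∞ := by
        rw [setLIntegral_const]
        exact ENNReal.mul_lt_top (ENNReal.rpow_lt_top_of_nonneg hr (by simp)) (by simp)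

/-- The extremal functions are `v ^ (1 / (1 - p))` on `(x, t)`. -/
theorem hardyConst₁_le {u v : ℝ → ℝ≥0∞} (hv : Measurable v) {p q : ℝ} (hp0 : 0 < p)
    (hp1 : p < 1) (hq0 : 0 < q) {x : ℝ} {D : ℝ≥0∞}
    (hD : ∀ f, Measurable f → hardyNorm p q u v x f ≤ D * ∫⁻ s in Ioi x, f s) :
    hardyConst₁ p q u v x ≤ D := by
  have h1 : 0 < 1 - p := by linarith
  have hσ : 0 < 1 / (1 - p) := by positivity
  refine iSup₂_le fun t ht => ?_
  have key : ∀ n, (∫⁻ s in Ioo x t, trunc v n s ^ (1 / (1 - p))) ^ ((1 - p) / p) *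
      (∫⁻ s in Ioi t, u s) ^ (1 / q) ≤ D := by
    intro n
    refine rpow_mul_le_of_rpow_add_one_mul_le (by positivity)
      (setLIntegral_trunc_rpow_lt_top v hσ.le n x t).ne ?_
    set f := (Ioo x t).indicator fun s => trunc v n s ^ (1 / (1 - p)) with hf
    have hfm : Measurable f := ((measurable_trunc hv n).pow_const _).indicator measurableSet_Ioo
    have hfint : ∫⁻ s in Ioi x, f s = ∫⁻ s in Ioo x t, trunc v n s ^ (1 / (1 - p)) := by
      rw [hf, setLIntegral_indicator measurableSet_Ioo, inter_eq_left.2 Ioo_subset_Ioi_self]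
    rw [← hfint]
    refine le_trans ?_ (hD f hfm)
    have hlow : ∀ r ∈ Ioi t, ∫⁻ s in Ioi x, f s ≤ ∫⁻ s in Ioo x r, f s ^ p * v s := by
      intro r hr
      rw [hfint]
      calc ∫⁻ s in Ioo x t, trunc v n s ^ (1 / (1 - p))
          ≤ ∫⁻ s in Ioo x t, f s ^ p * v s := by
            refine setLIntegral_mono' measurableSet_Ioo fun s hs => ?_
            rw [hf, indicator_of_mem hs]
            conv_lhs => rw [← rpow_one_div_one_sub _ hp0 hp1]
            gcongr
            exact trunc_le v n s
        _ ≤ _ := lintegral_mono_set (Ioo_subset_Ioo_right (le_of_lt hr))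
    rw [hardyNorm, one_div, ENNReal.le_rpow_inv_iff hq0, ENNReal.mul_rpow_of_nonneg _ _ hq0.le,
      ← ENNReal.rpow_mul, ← ENNReal.rpow_mul, inv_mul_cancel₀ hq0.ne', ENNReal.rpow_one,
      show ((1 - p) / p + 1) * q = q / p by field_simp; ring]
    have htx : Ioi t ⊆ Ioi x := Ioi_subset_Ioi (le_of_lt ht)
    refine le_trans ?_ (lintegral_mono_set htx)
    refine le_trans ?_ (setLIntegral_mono' measurableSet_Ioi fun r hr =>
      mul_le_mul_left (ENNReal.rpow_le_rpow (hlow r hr) (by positivity : 0 ≤ q / p)) (u r))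
    exact lintegral_const_mul_le _ _
  have e : ∫⁻ s in Ioo x t, v s ^ (1 / (1 - p))
      = ⨆ n, ∫⁻ s in Ioo x t, trunc v n s ^ (1 / (1 - p)) := by
    rw [← lintegral_iSup (fun n => (measurable_trunc hv n).pow_const _)
      (fun i j hij s => ENNReal.rpow_le_rpow (monotone_trunc v hij s) hσ.le)]
    simp only [iSup_trunc_rpow v hσ]
  have hsup := iSup_rpow_mul_iSup (a := fun n => ∫⁻ s in Ioo x t, trunc v n s ^ (1 / (1 - p)))
    (b := fun _ => (∫⁻ s in Ioi t, u s) ^ (1 / q)) (r := (1 - p) / p)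
    (fun i j hij => lintegral_mono fun s => ENNReal.rpow_le_rpow (monotone_trunc v hij s) hσ.le)
    monotone_const (by positivity)
  rw [iSup_const] at hsup
  rw [e, hsup]
  exact iSup_le key

/-- Fubini's theorem on the triangle `x < s < t`. -/
theorem setLIntegral_setLIntegral_Ioi_swap {h k : ℝ → ℝ≥0∞} (hh : Measurable h)
    (hk : Measurable k) (x : ℝ) :
    ∫⁻ s in Ioi x, h s * ∫⁻ t in Ioi s, k t = ∫⁻ t in Ioi x, (∫⁻ s in Ioo x t, h s) * k t := by
  have hm : Measurable (Function.uncurry fun s t : ℝ => (Ioi s).indicator (fun t => h s * k t) t) := by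
    have : (Function.uncurry fun s t : ℝ => (Ioi s).indicator (fun t => h s * k t) t)
        = {z : ℝ × ℝ | z.1 < z.2}.indicator fun z => h z.1 * k z.2 := by
      ext ⟨s, t⟩
      simp [indicator]
    rw [this]
    exact ((hh.comp measurable_fst).mul (hk.comp measurable_snd)).indicator
      (measurableSet_lt measurable_fst measurable_snd)
  have hswap := lintegral_lintegral_swap (μ := volume.restrict (Ioi x))
    (ν := volume.restrict (Ioi x)) hm.aemeasurable
  calc ∫⁻ s in Ioi x, h s * ∫⁻ t in Ioi s, k t
      = ∫⁻ s in Ioi x, ∫⁻ t in Ioi x, (Ioi s).indicator (fun t => h s * k t) t := by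
        refine setLIntegral_congr_fun measurableSet_Ioi fun s hs => ?_
        rw [setLIntegral_indicator measurableSet_Ioi,
          inter_eq_left.2 (Ioi_subset_Ioi (le_of_lt hs)), lintegral_const_mul _ hk]
    _ = ∫⁻ t in Ioi x, ∫⁻ s in Ioi x, (Ioi s).indicator (fun t => h s * k t) t := hswap
    _ = _ := by
        refine setLIntegral_congr_fun measurableSet_Ioi fun t _ => ?_
        rw [← lintegral_mul_const _ hh, ← Iio_inter_Ioi, ← setLIntegral_indicator measurableSet_Iio]
        refine lintegral_congr fun s => ?_
        by_cases hst : s < t <;> simp [hst, indicator]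

/-- With `σ = v ^ (1 / (1 - p))`, `V(t) = ∫ₓᵗ σ` and `U(t) = ∫ₜ^∞ u`, the function
`f = σ V ^ (a - 1) U ^ (b + 1)` is extremal: both sides of Hardy's inequality for `f` are
comparable with powers of `∫ V ^ a U ^ b u`. -/
theorem hardyConst₂_le_of_finite {u v : ℝ → ℝ≥0∞} (hu : Measurable u) (hv : Measurable v)
    {p q : ℝ} (hp0 : 0 < p) (hpq : p < q) (hq : q < 1) {x : ℝ} {D : ℝ≥0∞}
    (hfin : ∫⁻ t in Ioi x,
      (∫⁻ s in Ioo x t, v s ^ (1 / (1 - p))) ^ (q * (1 - p) / (p * (1 - q))) *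
        (∫⁻ s in Ioi t, u s) ^ (q / (1 - q)) * u t ≠ ∞)
    (hD : ∀ f, Measurable f → hardyNorm p q u v x f ≤ D * ∫⁻ s in Ioi x, f s) :
    hardyConst₂ p q u v x
      ≤ 2 ^ ((1 - p) / (p * (1 - q))) * 2 ^ (1 / (1 - q)) * D := by
  have hp1 : 0 < 1 - p := by linarith
  have hq1 : 0 < 1 - q := by linarith
  have hq0 : 0 < q := by linarith
  set σ : ℝ → ℝ≥0∞ := fun s => v s ^ (1 / (1 - p)) with hσ
  have hσm : Measurable σ := hv.pow_const _
  set V : ℝ → ℝ≥0∞ := fun t => ∫⁻ s in Ioo x t, σ s with hV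
  set U : ℝ → ℝ≥0∞ := fun t => ∫⁻ s in Ioi t, u s with hU
  have hVm : Measurable V := measurable_setLIntegral_Ioo _ _
  have hUm : Measurable U := measurable_setLIntegral_Ioi _
  have hVmono : Monotone V := monotone_setLIntegral_Ioo _ _
  have hUanti : Antitone U := antitone_setLIntegral_Ioi _
  set a := q * (1 - p) / (p * (1 - q)) with ha
  set b := q / (1 - q) with hb
  have ha1 : 0 ≤ a - 1 := by
    rw [ha, sub_nonneg, le_div_iff₀ (by positivity)]
    nlinarith
  have ha0 : 0 < a := by linarith
  have hb0 : 0 < b := by positivity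
  set I := ∫⁻ t in Ioi x, V t ^ a * U t ^ b * u t with hI
  set f : ℝ → ℝ≥0∞ := fun s => σ s * V s ^ (a - 1) * U s ^ (b + 1) with hf
  have hhm : Measurable fun s => σ s * V s ^ (a - 1) := hσm.mul (hVm.pow_const _)
  have hfm : Measurable f := hhm.mul (hUm.pow_const _)
  -- Fubini, after estimating `U(s) ^ (b + 1)` by `∫ₛ^∞ U ^ b u`
  have hR : ∫⁻ s in Ioi x, f s ≤ 2 ^ (b + 1) * I := by
    calc ∫⁻ s in Ioi x, f s
        ≤ ∫⁻ s in Ioi x, 2 ^ (b + 1) *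
            ((σ s * V s ^ (a - 1)) * ∫⁻ t in Ioi s, U t ^ b * u t) := by
          refine lintegral_mono fun s => ?_
          simp only [hf]
          rw [mul_left_comm]
          gcongr
          refine (setLIntegral_rpow_le_setLIntegral_Ioi hu hb0.le).trans ?_
          gcongr
          exact lintegral_mono_set inter_subset_left
      _ = 2 ^ (b + 1) * ∫⁻ t in Ioi x,
            (∫⁻ s in Ioo x t, σ s * V s ^ (a - 1)) * (U t ^ b * u t) := by
          have hm : Measurable fun t => U t ^ b * u t := (hUm.pow_const _).mul hu
          rw [lintegral_const_mul' _ _ (ENNReal.rpow_ne_top_of_nonneg (by positivity) (by norm_num)),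
            setLIntegral_setLIntegral_Ioi_swap hhm hm]
      _ ≤ 2 ^ (b + 1) * I := by
          gcongr 2 ^ (b + 1) * ?_
          refine lintegral_mono fun t => ?_
          simp only
          rw [mul_assoc (V t ^ a)]
          gcongr
          calc ∫⁻ s in Ioo x t, σ s * V s ^ (a - 1)
              ≤ ∫⁻ s in Ioo x t, σ s * V t ^ (a - 1) :=
                setLIntegral_mono' measurableSet_Ioo fun s hs => by
                  gcongr
                  exact hVmono hs.2.le
            _ = V t * V t ^ (a - 1) := by rw [lintegral_mul_const _ hσm]
            _ = V t ^ a := by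
                nth_rewrite 1 [← ENNReal.rpow_one (V t)]
                rw [← ENNReal.rpow_add_of_nonneg _ _ zero_le_one ha1]
                congr 1
                ring
  -- `U` decreases, so `∫ₓᵗ f ^ p v` is at least `U(t) ^ (p (b + 1)) ∫ₓᵗ V ^ γ σ`
  have hL : I ≤ 2 ^ a * hardyNorm p q u v x f ^ q := by
    rw [hardyNorm, ← ENNReal.rpow_mul, one_div_mul_cancel hq0.ne', ENNReal.rpow_one,
      ← lintegral_const_mul' _ _ (ENNReal.rpow_ne_top_of_nonneg ha0.le (by norm_num))]
    refine lintegral_mono fun t => ?_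
    simp only
    rw [← mul_assoc]
    gcongr ?_ * _
    set γ := p * (a - 1) with hγ
    have hγ0 : 0 ≤ γ := by positivity
    have hγa : (γ + 1) * (q / p) = a := by
      rw [hγ, ha]
      field_simp
      ring
    have hba : p * (b + 1) * (q / p) = b := by
      rw [hb]
      field_simp
      ring
    have h1 : V t ^ (γ + 1) ≤ 2 ^ (γ + 1) * ∫⁻ s in Ioo x t, V s ^ γ * σ s := by
      refine (setLIntegral_rpow_le_setLIntegral_Iio hσm hγ0).trans ?_
      gcongr
      exact lintegral_mono_set fun r hr => ⟨hr.2.1, hr.1⟩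
    have h2 : (∫⁻ s in Ioo x t, V s ^ γ * σ s) * U t ^ (p * (b + 1))
        ≤ ∫⁻ s in Ioo x t, f s ^ p * v s := by
      refine (lintegral_mul_const_le _ _).trans ?_
      refine setLIntegral_mono' measurableSet_Ioo fun s hs => ?_
      calc V s ^ γ * σ s * U t ^ (p * (b + 1)) ≤ V s ^ γ * σ s * U s ^ (p * (b + 1)) := by
            gcongr
            exact hUanti hs.2.le
        _ = f s ^ p * v s := by
            have e := rpow_one_div_one_sub (v s) hp0 (by linarith : p < 1)
            have e' : σ s ^ p * v s = σ s := e
            simp only [hf]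
            rw [ENNReal.mul_rpow_of_nonneg _ _ hp0.le, ENNReal.mul_rpow_of_nonneg _ _ hp0.le,
              ← ENNReal.rpow_mul (V s), ← ENNReal.rpow_mul (U s), mul_comm (a - 1),
              mul_comm (b + 1), ← hγ]
            conv_lhs => rw [← e']
            ring
    have h3 : V t ^ (γ + 1) * U t ^ (p * (b + 1))
        ≤ 2 ^ (γ + 1) * ∫⁻ s in Ioo x t, f s ^ p * v s := by
      refine (mul_le_mul_left h1 _).trans ?_
      rw [mul_assoc]
      gcongr
    have hqp : 0 ≤ q / p := by positivity
    have h4 := ENNReal.rpow_le_rpow h3 hqp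
    rwa [ENNReal.mul_rpow_of_nonneg _ _ hqp, ENNReal.mul_rpow_of_nonneg _ _ hqp,
      ← ENNReal.rpow_mul, ← ENNReal.rpow_mul, ← ENNReal.rpow_mul, hγa, hba] at h4
  have hmain : I ^ ((1 - q) / q + 1) * 1 ≤ 2 ^ (a / q) * 2 ^ (b + 1) * D * I := by
    have e : (1 - q) / q + 1 = 1 / q := by field_simp; ring
    calc I ^ ((1 - q) / q + 1) * 1 ≤ (2 ^ a * hardyNorm p q u v x f ^ q) ^ (1 / q) := by
          rw [mul_one, e]
          gcongr
      _ = 2 ^ (a / q) * hardyNorm p q u v x f := by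
          rw [ENNReal.mul_rpow_of_nonneg _ _ (by positivity), ← ENNReal.rpow_mul,
            ← ENNReal.rpow_mul, mul_one_div_cancel hq0.ne', ENNReal.rpow_one, mul_one_div]
      _ ≤ 2 ^ (a / q) * (D * (2 ^ (b + 1) * I)) := by
          gcongr
          exact (hD f hfm).trans (by gcongr)
      _ = _ := by ring
  have hfinal := rpow_mul_le_of_rpow_add_one_mul_le (by positivity) hfin hmain
  rw [mul_one] at hfinal
  have e1 : a / q = (1 - p) / (p * (1 - q)) := by rw [ha]; field_simp
  have e2 : b + 1 = 1 / (1 - q) := by rw [hb]; field_simp; ring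
  rw [e1, e2] at hfinal
  exact hfinal

/-- Truncating `u` and `v` makes the integral in `hardyConst₂` finite, so that it can be cancelled. -/
theorem hardyConst₂_le {u v : ℝ → ℝ≥0∞} (hu : Measurable u) (hv : Measurable v)
    {p q : ℝ} (hp0 : 0 < p) (hpq : p < q) (hq : q < 1) {x : ℝ} {D : ℝ≥0∞}
    (hD : ∀ f, Measurable f → hardyNorm p q u v x f ≤ D * ∫⁻ s in Ioi x, f s) :
    hardyConst₂ p q u v x
      ≤ 2 ^ ((1 - p) / (p * (1 - q))) * 2 ^ (1 / (1 - q)) * D := by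
  have hp1 : 0 < 1 - p := by linarith
  have hq1 : 0 < 1 - q := by linarith
  have hq0 : 0 < q := by linarith
  have hσ : 0 < 1 / (1 - p) := by positivity
  have ha : 0 < q * (1 - p) / (p * (1 - q)) := by positivity
  have hb : 0 < q / (1 - q) := by positivity
  let un : ℕ → ℝ → ℝ≥0∞ := fun n => (Iio (n : ℝ)).indicator (trunc u n)
  have hunm : ∀ n, Measurable (un n) := fun n => (measurable_trunc hu n).indicator measurableSet_Iio
  have hunle : ∀ n t, un n t ≤ n := fun n t =>
    (indicator_le_self' (fun _ _ => zero_le) t).trans (trunc_le_natCast u n t)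
  have hunu : ∀ n t, un n t ≤ u t := fun n t =>
    (indicator_le_self' (fun _ _ => zero_le) t).trans (trunc_le u n t)
  have hun0 : ∀ (n : ℕ) (t : ℝ), (n : ℝ) ≤ t → un n t = 0 := fun n t ht =>
    indicator_of_notMem (by simpa using ht) _
  have hunmono : Monotone un := fun i j hij t => by
    have hij' : (i : ℝ) ≤ j := by exact_mod_cast hij
    exact (indicator_le_indicator_of_subset (Iio_subset_Iio hij') (fun _ => zero_le) t).trans
      (indicator_le_indicator (monotone_trunc u hij t))
  have hunsup : ∀ t, ⨆ n, un n t = u t := fun t => by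
    refine le_antisymm (iSup_le fun n => hunu n t) ?_
    rw [← iSup_trunc u t]
    refine iSup_le fun n => ?_
    obtain ⟨m, hm⟩ := exists_nat_gt t
    refine le_iSup_of_le (max n m) ?_
    have ht : t ∈ Iio ((max n m : ℕ) : ℝ) := hm.trans_le (by exact_mod_cast le_max_right n m)
    simp only [un]
    rw [indicator_of_mem ht]
    exact monotone_trunc u (le_max_left n m) t
  have hUn : ∀ n t, ∫⁻ s in Ioi t, un n s ≤ n * volume (Ioo t (n : ℝ)) := fun n t => by
    calc ∫⁻ s in Ioi t, un n s ≤ ∫⁻ s in Ioi t, (Iio (n : ℝ)).indicator (fun _ => (n : ℝ≥0∞)) s :=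
          lintegral_mono fun s => indicator_le_indicator (trunc_le_natCast u n s)
      _ = _ := by rw [setLIntegral_indicator measurableSet_Iio, setLIntegral_const, Iio_inter_Ioi]
  have hkey : ∀ n, ∫⁻ t in Ioi x,
      (∫⁻ s in Ioo x t, trunc v n s ^ (1 / (1 - p))) ^ (q * (1 - p) / (p * (1 - q))) *
        ((∫⁻ s in Ioi t, un n s) ^ (q / (1 - q)) * un n t)
        ≤ (2 ^ ((1 - p) / (p * (1 - q))) * 2 ^ (1 / (1 - q)) * D) ^ ((1 - q) / q)⁻¹ := by
    intro n
    rw [ENNReal.le_rpow_inv_iff (by positivity)]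
    have h := hardyConst₂_le_of_finite (hunm n) (measurable_trunc hv n) hp0 hpq hq (x := x)
      (D := D) ?_ fun f hf => (hardyNorm_mono hp0 hq0 (hunu n) (trunc_le v n) x f).trans (hD f hf)
    · simpa only [hardyConst₂, mul_assoc] using h
    · set M : ℝ≥0∞ := (∫⁻ s in Ioo x n, trunc v n s ^ (1 / (1 - p))) ^
        (q * (1 - p) / (p * (1 - q))) * (n * volume (Ioo x (n : ℝ))) ^ (q / (1 - q)) * n with hM
      have hMfin : M < ∞ := by
        refine ENNReal.mul_lt_top (ENNReal.mul_lt_top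
          (ENNReal.rpow_lt_top_of_nonneg ha.le (setLIntegral_trunc_rpow_lt_top v hσ.le n x n).ne)
          (ENNReal.rpow_lt_top_of_nonneg hb.le ?_)) (by simp)
        exact (ENNReal.mul_lt_top (by simp) (by simp)).ne
      refine (lt_of_le_of_lt (b := ∫⁻ t in Ioi x, (Iio (n : ℝ)).indicator (fun _ => M) t) ?_ ?_).ne
      · refine setLIntegral_mono' measurableSet_Ioi fun t ht => ?_
        by_cases htn : t < n
        · rw [indicator_of_mem (show t ∈ Iio (n : ℝ) from htn), hM]
          gcongr
          · refine (hUn n t).trans ?_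
            gcongr
            exact le_of_lt ht
          · exact hunle n t
        · rw [hun0 n t (not_lt.1 htn), mul_zero]
          exact zero_le
      · rw [setLIntegral_indicator measurableSet_Iio, setLIntegral_const, Iio_inter_Ioi]
        exact ENNReal.mul_lt_top hMfin (by simp)
  have hfinal := setLIntegral_iSup_le (x := x) ha
    (g := fun n s => trunc v n s ^ (1 / (1 - p)))
    (h := fun n t => (∫⁻ s in Ioi t, un n s) ^ (q / (1 - q)) * un n t)
    (fun i j hij s => ENNReal.rpow_le_rpow (monotone_trunc v hij s) hσ.le)
    (fun n => (measurable_trunc hv n).pow_const _)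
    (fun i j hij t => by
      simp only
      gcongr
      · exact hunmono hij _
      · exact hunmono hij _)
    (fun n => ((measurable_setLIntegral_Ioi _).pow_const _).mul (hunm n)) hkey
  have hsup : ∀ t, ⨆ n, (∫⁻ s in Ioi t, un n s) ^ (q / (1 - q)) * un n t
      = (∫⁻ s in Ioi t, u s) ^ (q / (1 - q)) * u t := fun t => by
    rw [← iSup_rpow_mul_iSup (fun i j hij => lintegral_mono (hunmono hij))
      (fun i j hij => hunmono hij t) hb, ← lintegral_iSup hunm hunmono]
    simp only [hunsup]
  simp only [hsup, iSup_trunc_rpow v hσ] at hfinal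
  rw [ENNReal.le_rpow_inv_iff (by positivity)] at hfinal
  simpa only [hardyConst₂, mul_assoc] using hfinal

/-! ### Reduction to half-lines -/

/-- For `f` supported in `(x, ∞)` the right-hand side of the embedding is at most
`‖f‖₁ (∫ₓ^∞ w) ^ (1 / θ)`. -/
theorem hardyNorm_le_of_holdsWith {p q θ : ℝ} (hp0 : 0 < p) (hq0 : 0 < q) (hθ : 0 < θ)
    {u v w : ℝ → ℝ≥0∞} (hw : MPlus w) {C : ℝ≥0} (hC : HoldsWith p q θ u v w C) {x : ℝ} (hx : 0 < x)
    {f : ℝ → ℝ≥0∞} (hf : Measurable f) :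
    hardyNorm p q u v x f ≤ C * (∫⁻ s in Ioi x, w s) ^ (1 / θ) * ∫⁻ s in Ioi x, f s := by
  set g := (Ioi x).indicator f with hg
  have hgm : Measurable g := hf.indicator measurableSet_Ioi
  have hsub : Ioi x ⊆ Ioi 0 := Ioi_subset_Ioi hx.le
  have h1 : hardyNorm p q u v x f ≤ cesaro p q u v g := by
    unfold hardyNorm cesaro
    refine ENNReal.rpow_le_rpow ?_ (by positivity)
    refine le_trans ?_ (lintegral_mono_set hsub)
    refine setLIntegral_mono' measurableSet_Ioi fun t ht => ?_
    gcongr ?_ ^ (q / p) * _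
    refine le_trans ?_ (lintegral_mono_set (Ioo_subset_Ioo_left hx.le))
    refine setLIntegral_mono' measurableSet_Ioo fun s hs => ?_
    rw [hg, indicator_of_mem (show s ∈ Ioi x from hs.1)]
  have h2 : (∫⁻ t in Ioi (0 : ℝ), (∫⁻ s in Ioo 0 t, g s) ^ θ * w t) ^ (1 / θ)
      ≤ (∫⁻ s in Ioi x, w s) ^ (1 / θ) * ∫⁻ s in Ioi x, f s := by
    rw [one_div, ENNReal.rpow_inv_le_iff hθ, ENNReal.mul_rpow_of_nonneg _ _ hθ.le,
      ← ENNReal.rpow_mul, inv_mul_cancel₀ hθ.ne', ENNReal.rpow_one]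
    have hg1 : ∀ t, ∫⁻ s in Ioo 0 t, g s ≤ ∫⁻ s in Ioi x, f s := fun t => by
      rw [← lintegral_indicator measurableSet_Ioi]
      exact setLIntegral_le_lintegral _ _
    have hg2 : ∀ t, t ≤ x → ∫⁻ s in Ioo 0 t, g s = 0 := fun t ht => by
      rw [hg, setLIntegral_indicator measurableSet_Ioi]
      have : Ioi x ∩ Ioo 0 t = ∅ := by
        ext s
        simp only [mem_inter_iff, mem_Ioi, mem_Ioo, mem_empty_iff_false, iff_false]
        intro h
        linarith [h.1, h.2.2]
      simp [this]
    calc ∫⁻ t in Ioi (0 : ℝ), (∫⁻ s in Ioo 0 t, g s) ^ θ * w t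
        ≤ ∫⁻ t in Ioi (0 : ℝ), (Ioi x).indicator
            (fun t => w t * (∫⁻ s in Ioi x, f s) ^ θ) t := by
          refine lintegral_mono fun t => ?_
          by_cases ht : x < t
          · rw [indicator_of_mem (show t ∈ Ioi x from ht), mul_comm]
            exact mul_le_mul' le_rfl (ENNReal.rpow_le_rpow (hg1 t) hθ.le)
          · simp only
            rw [hg2 t (not_lt.1 ht), ENNReal.zero_rpow_of_pos hθ, zero_mul]
            exact zero_le
      _ = (∫⁻ s in Ioi x, w s) * (∫⁻ s in Ioi x, f s) ^ θ := by
          rw [setLIntegral_indicator measurableSet_Ioi, inter_eq_left.2 hsub,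
            lintegral_mul_const'' _ (hw.mono_measure (Measure.restrict_mono hsub le_rfl))]
  calc _ ≤ _ := h1
    _ ≤ _ := hC g hgm.aemeasurable
    _ ≤ C * ((∫⁻ s in Ioi x, w s) ^ (1 / θ) * ∫⁻ s in Ioi x, f s) := by gcongr
    _ = _ := by ring

/-! ### Decomposition along the level sets of the primitive -/

theorem hardyNorm_zero_le {p q : ℝ} (hp0 : 0 < p) (hq0 : 0 < q) (u v : ℝ → ℝ≥0∞) {f : ℝ → ℝ≥0∞}
    {b : ℝ} (hf : ∀ s < b, f s = 0) : hardyNorm p q u v 0 f ≤ hardyNorm p q u v b f := by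
  have hr : 0 < q / p := by positivity
  have h1 : ∀ t, ∫⁻ s in Ioo 0 t, f s ^ p * v s ≤ ∫⁻ s in Ioo b t, f s ^ p * v s := by
    intro t
    calc ∫⁻ s in Ioo 0 t, f s ^ p * v s
        ≤ ∫⁻ s in Ioo 0 t, (Ici b).indicator (fun s => f s ^ p * v s) s := by
          refine lintegral_mono fun s => ?_
          by_cases hs : s < b
          · simp [hf s hs, hp0]
          · rw [indicator_of_mem (show s ∈ Ici b from not_lt.1 hs)]
      _ ≤ ∫⁻ s in Ico b t, f s ^ p * v s := by
          rw [setLIntegral_indicator measurableSet_Ici]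
          exact lintegral_mono_set fun s hs => ⟨hs.1, hs.2.2⟩
      _ = _ := setLIntegral_congr Ioo_ae_eq_Ico.symm
  unfold hardyNorm
  refine ENNReal.rpow_le_rpow ?_ (by positivity)
  rw [← lintegral_indicator (measurableSet_Ioi (a := b))]
  refine le_trans (lintegral_mono fun t => ?_) (setLIntegral_le_lintegral (Ioi 0) _)
  refine (mul_le_mul' (ENNReal.rpow_le_rpow (h1 t) hr.le) le_rfl).trans ?_
  by_cases ht : b < t
  · rw [indicator_of_mem (show t ∈ Ioi b from ht)]
  · simp [Ioo_eq_empty ht, hr]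

/-- The `p`-th power of `hardyNorm` is countably subadditive over pieces of `f`: it is the norm of the
primitive of `f ^ p * v` in `L^(q / p)(u)`. -/
theorem hardyNorm_rpow_le_tsum {p q : ℝ} (hp0 : 0 < p) (hpq : p ≤ q) {u v f : ℝ → ℝ≥0∞}
    (hu : Measurable u) (hv : Measurable v) {x : ℝ} {fk : ℤ → ℝ → ℝ≥0∞}
    (hfk : ∀ k, Measurable (fk k))
    (hle : ∀ᵐ s ∂(volume.restrict (Ioi x)), f s ^ p * v s ≤ ∑' k, fk k s ^ p * v s) :
    hardyNorm p q u v x f ^ p ≤ ∑' k, hardyNorm p q u v x (fk k) ^ p := by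
  have hq0 : 0 < q := by linarith
  have hr : 1 ≤ q / p := (one_le_div hp0).2 hpq
  have hr0 : 0 < q / p := by linarith
  have e : ∀ g : ℝ → ℝ≥0∞, hardyNorm p q u v x g ^ p
      = (∫⁻ t, (∫⁻ s in Ioo x t, g s ^ p * v s) ^ (q / p)
          ∂((volume.restrict (Ioi x)).withDensity u)) ^ (1 / (q / p)) := by
    intro g
    rw [lintegral_withDensity_eq_lintegral_mul _ hu
      ((measurable_setLIntegral_Ioo (fun s => g s ^ p * v s) x).pow_const _), hardyNorm,
      ← ENNReal.rpow_mul]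
    simp only [Pi.mul_apply, mul_comm (u _)]
    congr 1
    field_simp
  simp only [e]
  refine le_trans ?_ (lintegral_tsum_rpow_le _ hr _ fun k => measurable_setLIntegral_Ioo _ x)
  refine ENNReal.rpow_le_rpow (lintegral_mono fun t => ENNReal.rpow_le_rpow ?_ hr0.le)
    (by positivity)
  have hm : ∀ k, Measurable fun s => fk k s ^ p * v s := fun k => ((hfk k).pow_const p).mul hv
  rw [← lintegral_tsum fun k => (hm k).aemeasurable]
  exact lintegral_mono_ae (ae_restrict_of_ae_restrict_of_subset Ioo_subset_Ioi_self hle)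

/-- The embedding follows from Hardy's inequalities on all half-lines `(x, ∞)` with constants
`K x ≲ A (∫ₓ^∞ w) ^ (1 / θ)`: cut `f` along the dyadic shells of its primitive `F`, add up the
pieces by Minkowski's inequality in `L^(q / p)(u)`, and use `θ ≤ p` to pass to the `θ`-th powers. -/
theorem cesaro_le_of_hardy {p q θ : ℝ} (hθ : 0 < θ) (hθp : θ ≤ p) (hpq : p ≤ q)
    {u v w f : ℝ → ℝ≥0∞} (hu : Measurable u) (hv : Measurable v) (hw : MPlus w)
    (hf : Measurable f) (hfin : ∀ t, ∫⁻ s in Ioo 0 t, f s < ∞)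
    {K : ℝ → ℝ≥0∞} {c A : ℝ≥0∞}
    (hK : ∀ x > 0, ∀ g, Measurable g → ∫⁻ s in Ioi x, g s < ∞ →
      hardyNorm p q u v x g ≤ c * (K x * ∫⁻ s in Ioi x, g s))
    (hA : ∀ x > 0, K x ≤ A * (∫⁻ s in Ioi x, w s) ^ (1 / θ)) :
    cesaro p q u v f ≤ 2 * c * ((1 - (2 : ℝ≥0∞) ^ (-θ))⁻¹) ^ (1 / θ) * A *
      (∫⁻ t in Ioi (0 : ℝ), (∫⁻ s in Ioo 0 t, f s) ^ θ * w t) ^ (1 / θ) := by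
  have hp0 : 0 < p := by linarith
  have hq0 : 0 < q := by linarith
  have hpθ : 1 ≤ p / θ := (one_le_div hθ).2 hθp
  set F : ℝ → ℝ≥0∞ := fun t => ∫⁻ s in Ioo 0 t, f s with hF
  have hFm : Measurable F := measurable_setLIntegral_Ioo _ _
  set ν := (volume.restrict (Ioi 0)).withDensity f with hν
  have hνI : ∀ t, ν (Iio t) = F t := fun t => by
    rw [hν, withDensity_apply _ measurableSet_Iio, Measure.restrict_restrict measurableSet_Iio,
      inter_comm, Ioi_inter_Iio, hF]
  have hSm : ∀ k, MeasurableSet (dyadicShell F k) := measurableSet_dyadicShell hFm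
  have hS0 : ∀ k, dyadicShell F k ⊆ Ioi 0 := dyadicShell_subset_Ioi f 0
  set fk : ℤ → ℝ → ℝ≥0∞ := fun k => (dyadicShell F k).indicator f with hfk
  have hfkm : ∀ k, Measurable (fk k) := fun k => hf.indicator (hSm k)
  set wk : ℤ → ℝ≥0∞ := fun k => ∫⁻ t in Ioi (0 : ℝ), (F ⁻¹' Ici (2 ^ k)).indicator w t with hwk
  have hL : ∀ c, ν {t | F t ≤ c} ≤ c := fun c => by
    have := measure_setOf_measure_Iio_le ν c
    simpa only [hνI] using this
  -- `f` vanishes a.e. where its primitive does, so the shells carry all of `f`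
  have hzero : ∀ᵐ s ∂(volume.restrict (Ioi 0)), F s = 0 → f s = 0 := by
    have hm : MeasurableSet {t | F t ≤ 0} := hFm measurableSet_Iic
    have h0 := le_antisymm (hL 0) zero_le
    rw [hν, withDensity_apply _ hm, lintegral_eq_zero_iff hf, Filter.EventuallyEq,
      ae_restrict_iff' hm] at h0
    filter_upwards [h0] with s hs h
    exact hs h.le
  have hdec : ∀ᵐ s ∂(volume.restrict (Ioi 0)), f s ^ p * v s ≤ ∑' k, fk k s ^ p * v s := by
    filter_upwards [hzero] with s hs
    rcases eq_or_ne (F s) 0 with h0 | h0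
    · simp [hs h0, hp0]
    obtain ⟨k, hk⟩ := ENNReal.exists_mem_Ico_zpow h0 (hfin s).ne (y := 2) (by norm_num)
      (by norm_num)
    refine le_trans (le_of_eq ?_) (ENNReal.le_tsum k)
    simp only [hfk]
    rw [indicator_of_mem (show s ∈ dyadicShell F k from hk)]
  have hpiece : ∀ k, hardyNorm p q u v 0 (fk k)
      ≤ c * (A * wk k ^ (1 / θ) * 2 ^ (k + 1)) := by
    intro k
    rcases (dyadicShell F k).eq_empty_or_nonempty with he | ⟨t₀, ht₀⟩
    · have : fk k = fun _ => 0 := by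
        ext s
        simp [hfk, he]
      have hr : 0 < q / p := by positivity
      simp [this, hardyNorm, hp0, hr, hq0]
    obtain ⟨b, hb1, hb2, hb3⟩ := exists_level ν (two_zpow_pos k) (by rw [hνI]; exact ht₀.1)
      (fun t => by rw [hνI]; exact hfin t)
    simp only [hνI] at hb1 hb2 hb3
    have hb0 : 0 < b := by
      by_contra hcon
      simp only [hF, Ioo_eq_empty hcon, Measure.restrict_empty, lintegral_zero_measure] at hb3
      exact absurd hb3 (two_zpow_pos k).ne
    have hint : ∫⁻ s in Ioi b, fk k s ≤ 2 ^ (k + 1) := by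
      calc ∫⁻ s in Ioi b, fk k s ≤ ∫⁻ s in dyadicShell F k, f s := by
            rw [← lintegral_indicator (hSm k)]
            exact setLIntegral_le_lintegral _ _
        _ = ν (dyadicShell F k) := by
            rw [hν, withDensity_apply _ (hSm k), Measure.restrict_restrict (hSm k),
              inter_eq_left.2 (hS0 k)]
        _ ≤ ν {t | F t ≤ 2 ^ (k + 1)} := measure_mono fun t ht => ht.2.le
        _ ≤ _ := hL _
    have hW : ∫⁻ s in Ioi b, w s ≤ wk k := by
      simp only [hwk]
      rw [setLIntegral_indicator (hFm measurableSet_Ici)]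
      refine lintegral_mono_set fun t ht => ⟨?_, hb0.trans ht⟩
      by_contra hcon
      exact absurd (hb1 t (not_le.1 hcon)) (not_lt.2 (le_of_lt ht))
    calc hardyNorm p q u v 0 (fk k) ≤ hardyNorm p q u v b (fk k) := by
          refine hardyNorm_zero_le hp0 hq0 u v fun s hs => ?_
          refine indicator_of_notMem (fun hmem => ?_) _
          exact absurd (hb2 s hmem.1) (not_le.2 hs)
      _ ≤ c * (K b * ∫⁻ s in Ioi b, fk k s) :=
          hK b hb0 _ (hfkm k) (hint.trans_lt (two_zpow_lt_top _))
      _ ≤ _ := by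
          gcongr
          exact (hA b hb0).trans (by gcongr)
  have hsum : ∑' k : ℤ, ((2 : ℝ≥0∞) ^ k) ^ θ * wk k
      ≤ (1 - (2 : ℝ≥0∞) ^ (-θ))⁻¹ * ∫⁻ t in Ioi (0 : ℝ), F t ^ θ * w t := by
    have hm : ∀ k : ℤ, AEMeasurable (fun t => (if (2 : ℝ≥0∞) ^ k ≤ F t
        then ((2 : ℝ≥0∞) ^ k) ^ θ else 0) * w t) (volume.restrict (Ioi 0)) := fun k =>
      ((Measurable.ite (hFm measurableSet_Ici) measurable_const measurable_const).aemeasurable).mul hw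
    calc ∑' k : ℤ, ((2 : ℝ≥0∞) ^ k) ^ θ * wk k
        = ∑' k : ℤ, ∫⁻ t in Ioi (0 : ℝ), (if (2 : ℝ≥0∞) ^ k ≤ F t
            then ((2 : ℝ≥0∞) ^ k) ^ θ else 0) * w t := by
          congr 1 with k
          rw [← lintegral_const_mul' _ _
            (ENNReal.rpow_ne_top_of_nonneg hθ.le (two_zpow_lt_top k).ne)]
          refine lintegral_congr fun t => ?_
          by_cases h : (2 : ℝ≥0∞) ^ k ≤ F t <;> simp [h, indicator]
      _ = ∫⁻ t in Ioi (0 : ℝ), (∑' k : ℤ, if (2 : ℝ≥0∞) ^ k ≤ F t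
            then ((2 : ℝ≥0∞) ^ k) ^ θ else 0) * w t := by
          rw [← lintegral_tsum hm]
          simp only [ENNReal.tsum_mul_right]
      _ ≤ ∫⁻ t in Ioi (0 : ℝ), (1 - (2 : ℝ≥0∞) ^ (-θ))⁻¹ * (F t ^ θ * w t) := by
          refine lintegral_mono fun t => ?_
          simp only
          rw [← mul_assoc]
          exact mul_le_mul' (tsum_dyadic_rpow_le hθ (F t)) le_rfl
      _ = _ := lintegral_const_mul'' _ ((hFm.pow_const θ).aemeasurable.mul hw)
  set R := ∫⁻ t in Ioi (0 : ℝ), F t ^ θ * w t with hR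
  set κ := (1 - (2 : ℝ≥0∞) ^ (-θ))⁻¹ with hκ
  have hfinal : cesaro p q u v f ^ p ≤ (2 * c * A * (κ * R) ^ (1 / θ)) ^ p := by
    calc cesaro p q u v f ^ p = hardyNorm p q u v 0 f ^ p := rfl
      _ ≤ ∑' k, hardyNorm p q u v 0 (fk k) ^ p := hardyNorm_rpow_le_tsum hp0 hpq hu hv hfkm hdec
      _ ≤ ∑' k, (2 * c * A) ^ p * (((2 : ℝ≥0∞) ^ k) ^ θ * wk k) ^ (p / θ) := by
          refine ENNReal.tsum_le_tsum fun k => ?_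
          refine (ENNReal.rpow_le_rpow (hpiece k) hp0.le).trans_eq ?_
          rw [two_zpow_add_one, ENNReal.mul_rpow_of_nonneg _ _ (by linarith : 0 ≤ p / θ),
            ← ENNReal.rpow_mul, mul_div_cancel₀ _ hθ.ne', ← one_div_mul_eq_div θ p,
            ENNReal.rpow_mul, ← ENNReal.mul_rpow_of_nonneg _ _ hp0.le,
            ← ENNReal.mul_rpow_of_nonneg _ _ hp0.le]
          congr 1
          ring
      _ ≤ (2 * c * A) ^ p * (κ * R) ^ (p / θ) := by
          rw [ENNReal.tsum_mul_left]
          gcongr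
          exact (tsum_rpow_le_rpow_tsum _ hpθ).trans (by gcongr)
      _ = _ := by
          rw [ENNReal.mul_rpow_of_nonneg (2 * c * A) _ hp0.le, ← ENNReal.rpow_mul,
            one_div_mul_eq_div]
  refine ((ENNReal.rpow_le_rpow_iff hp0).1 hfinal).trans_eq ?_
  rw [ENNReal.mul_rpow_of_nonneg _ _ (by positivity)]
  ring

/-! ### Two-sided bounds for the best constant -/

theorem setLIntegral_congr_of_ae_Ioi {f g : ℝ → ℝ≥0∞}
    (h : ∀ᵐ t ∂(volume.restrict (Ioi (0 : ℝ))), f t = g t) {S : Set ℝ} (hS : S ⊆ Ioi 0) :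
    ∫⁻ t in S, f t = ∫⁻ t in S, g t :=
  lintegral_congr_ae (ae_restrict_of_ae_restrict_of_subset hS h)

theorem hardyNorm_congr {p q x : ℝ} (hx : 0 ≤ x) {u u' v v' f f' : ℝ → ℝ≥0∞}
    (hu : ∀ᵐ t ∂(volume.restrict (Ioi (0 : ℝ))), u t = u' t)
    (hv : ∀ᵐ t ∂(volume.restrict (Ioi (0 : ℝ))), v t = v' t)
    (hf : ∀ᵐ t ∂(volume.restrict (Ioi (0 : ℝ))), f t = f' t) :
    hardyNorm p q u v x f = hardyNorm p q u' v' x f' := by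
  unfold hardyNorm
  have h1 : ∀ t, ∫⁻ s in Ioo x t, f s ^ p * v s = ∫⁻ s in Ioo x t, f' s ^ p * v' s := fun t =>
    setLIntegral_congr_of_ae_Ioi (by filter_upwards [hv, hf] with s h1 h2; rw [h1, h2])
      fun s hs => hx.trans_lt hs.1
  congr 1
  refine setLIntegral_congr_of_ae_Ioi ?_ (Ioi_subset_Ioi hx)
  filter_upwards [hu] with t ht
  rw [h1, ht]

theorem setLIntegral_rpow_congr {v v' : ℝ → ℝ≥0∞} {x : ℝ} (hx : 0 ≤ x)
    (hv : ∀ᵐ t ∂(volume.restrict (Ioi (0 : ℝ))), v t = v' t) (r t : ℝ) :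
    ∫⁻ s in Ioo x t, v s ^ r = ∫⁻ s in Ioo x t, v' s ^ r :=
  setLIntegral_congr_of_ae_Ioi (by filter_upwards [hv] with s h; rw [h]) fun _ hs => hx.trans_lt hs.1

theorem hardyConst₁_congr {p q x : ℝ} (hx : 0 ≤ x) {u u' v v' : ℝ → ℝ≥0∞}
    (hu : ∀ᵐ t ∂(volume.restrict (Ioi (0 : ℝ))), u t = u' t)
    (hv : ∀ᵐ t ∂(volume.restrict (Ioi (0 : ℝ))), v t = v' t) :
    hardyConst₁ p q u v x = hardyConst₁ p q u' v' x := by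
  unfold hardyConst₁
  refine iSup_congr fun t => iSup_congr fun ht => ?_
  rw [setLIntegral_rpow_congr hx hv,
    setLIntegral_congr_of_ae_Ioi hu (Ioi_subset_Ioi (hx.trans (le_of_lt ht)))]

theorem hardyConst₂_congr {p q x : ℝ} (hx : 0 ≤ x) {u u' v v' : ℝ → ℝ≥0∞}
    (hu : ∀ᵐ t ∂(volume.restrict (Ioi (0 : ℝ))), u t = u' t)
    (hv : ∀ᵐ t ∂(volume.restrict (Ioi (0 : ℝ))), v t = v' t) :
    hardyConst₂ p q u v x = hardyConst₂ p q u' v' x := by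
  unfold hardyConst₂
  congr 1
  refine setLIntegral_congr_of_ae_Ioi ?_ (Ioi_subset_Ioi hx)
  filter_upwards [hu, ae_restrict_mem measurableSet_Ioi] with t ht ht0
  rw [setLIntegral_rpow_congr hx hv, ht, setLIntegral_congr_of_ae_Ioi hu (Ioi_subset_Ioi (le_of_lt ht0))]

theorem IsWeight.setLIntegral_Ioi_ne_zero {w : ℝ → ℝ≥0∞} (hw : IsWeight w) {x : ℝ} (hx : 0 ≤ x) :
    ∫⁻ s in Ioi x, w s ≠ 0 := by
  have hsub : Ioi x ⊆ Ioi 0 := Ioi_subset_Ioi hx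
  intro h
  rw [lintegral_eq_zero_iff' (hw.1.mono_measure (Measure.restrict_mono hsub le_rfl))] at h
  have h2 := ae_restrict_of_ae_restrict_of_subset hsub hw.2
  have h3 : ∀ᵐ t ∂(volume.restrict (Ioi x)), False := by
    filter_upwards [h, h2] with t ht ht2
    exact ht2.1.ne' ht
  rw [Filter.eventually_false_iff_eq_bot, ae_eq_bot, Measure.restrict_eq_zero,
    Real.volume_Ioi] at h3
  exact ENNReal.top_ne_zero h3

/-- The abstract form of the result: if `K u v x` is equivalent to the best constant of Hardy's
inequality on `(x, ∞)`, then `sup_x (∫ₓ^∞ w) ^ (-1 / θ) K u v x` is equivalent to the best constant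
of the embedding. -/
theorem bestConstant_equiv {p q θ : ℝ} (hθ : 0 < θ) (hθp : θ ≤ p) (hpq : p ≤ q)
    {K : (ℝ → ℝ≥0∞) → (ℝ → ℝ≥0∞) → ℝ → ℝ≥0∞} {c c' : ℝ≥0∞} (hc0 : c ≠ 0) (hc : c ≠ ∞)
    (hc'0 : c' ≠ 0) (hc' : c' ≠ ∞)
    (hcongr : ∀ u u' v v' : ℝ → ℝ≥0∞, (∀ᵐ t ∂(volume.restrict (Ioi (0 : ℝ))), u t = u' t) →
      (∀ᵐ t ∂(volume.restrict (Ioi (0 : ℝ))), v t = v' t) → ∀ x > 0, K u v x = K u' v' x)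
    (hsuff : ∀ u v : ℝ → ℝ≥0∞, Measurable u → Measurable v → ∀ x > 0, ∀ g, Measurable g →
      ∫⁻ s in Ioi x, g s < ∞ → hardyNorm p q u v x g ≤ c * (K u v x * ∫⁻ s in Ioi x, g s))
    (hnec : ∀ u v : ℝ → ℝ≥0∞, Measurable u → Measurable v → ∀ x > 0, ∀ D : ℝ≥0∞,
      (∀ f, Measurable f → hardyNorm p q u v x f ≤ D * ∫⁻ s in Ioi x, f s) →
        K u v x ≤ c' * D) :
    (∀ u v w : ℝ → ℝ≥0∞, Admissible u v w → ((∃ C : ℝ≥0, HoldsWith p q θ u v w C) ↔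
        ⨆ x ∈ Ioi (0 : ℝ), (∫⁻ s in Ioi x, w s) ^ (-(1 / θ)) * K u v x < ∞)) ∧
      ∃ c₁ c₂ : ℝ≥0, 0 < c₁ ∧ 0 < c₂ ∧ ∀ u v w : ℝ → ℝ≥0∞, Admissible u v w →
        (c₁ : ℝ≥0∞) * ⨆ x ∈ Ioi (0 : ℝ), (∫⁻ s in Ioi x, w s) ^ (-(1 / θ)) * K u v x
            ≤ bestConstant p q θ u v w ∧
          bestConstant p q θ u v w
            ≤ (c₂ : ℝ≥0∞) * ⨆ x ∈ Ioi (0 : ℝ), (∫⁻ s in Ioi x, w s) ^ (-(1 / θ)) * K u v x := by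
  have hp0 : 0 < p := by linarith
  have hq0 : 0 < q := by linarith
  set κ : ℝ≥0∞ := 2 * c * ((1 - (2 : ℝ≥0∞) ^ (-θ))⁻¹) ^ (1 / θ) with hκ
  have h2θ : (2 : ℝ≥0∞) ^ (-θ) < 1 := ENNReal.rpow_lt_one_of_one_lt_of_neg (by norm_num) (by linarith)
  have hg0 : (1 - (2 : ℝ≥0∞) ^ (-θ))⁻¹ ≠ 0 :=
    ENNReal.inv_ne_zero.2 (ne_top_of_le_ne_top ENNReal.one_ne_top tsub_le_self)
  have hgt : (1 - (2 : ℝ≥0∞) ^ (-θ))⁻¹ ≠ ∞ := ENNReal.inv_ne_top.2 (tsub_pos_of_lt h2θ).ne'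
  have hκ0 : κ ≠ 0 := mul_ne_zero (mul_ne_zero (by norm_num) hc0)
    (ENNReal.rpow_pos (pos_iff_ne_zero.2 hg0) hgt).ne'
  have hκt : κ ≠ ∞ := ENNReal.mul_ne_top (ENNReal.mul_ne_top (by norm_num) hc)
    (ENNReal.rpow_ne_top_of_nonneg (by positivity) hgt)
  have hbounds : ∀ u v w : ℝ → ℝ≥0∞, Admissible u v w →
      c'⁻¹ * (⨆ x ∈ Ioi (0 : ℝ), (∫⁻ s in Ioi x, w s) ^ (-(1 / θ)) * K u v x)
          ≤ bestConstant p q θ u v w ∧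
        bestConstant p q θ u v w
          ≤ κ * ⨆ x ∈ Ioi (0 : ℝ), (∫⁻ s in Ioi x, w s) ^ (-(1 / θ)) * K u v x := by
    intro u v w h
    obtain ⟨u', hu'm, hu'⟩ := h.u_mem
    obtain ⟨v', hv'm, hv'⟩ := h.v_mem
    set A := ⨆ x ∈ Ioi (0 : ℝ), (∫⁻ s in Ioi x, w s) ^ (-(1 / θ)) * K u v x with hA
    have hW0 : ∀ x > 0, ∫⁻ s in Ioi x, w s ≠ 0 := fun x hx =>
      h.w_weight.setLIntegral_Ioi_ne_zero (le_of_lt hx)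
    have hWt : ∀ x > 0, ∫⁻ s in Ioi x, w s ≠ ∞ := fun x hx => (h.w_tail x hx).ne
    have hWmul : ∀ x > 0, (∫⁻ s in Ioi x, w s) ^ (1 / θ) * (∫⁻ s in Ioi x, w s) ^ (-(1 / θ)) = 1 :=
      fun x hx => by
        rw [← ENNReal.rpow_add _ _ (hW0 x hx) (hWt x hx), add_neg_cancel, ENNReal.rpow_zero]
    constructor
    · refine le_iInf₂ fun C hC => ?_
      have hC' : HoldsWith p q θ u' v' w C := fun f hf =>
        (hardyNorm_congr le_rfl hu' hv' (Filter.Eventually.of_forall fun _ => rfl)).symm.trans_le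
          (hC f hf)
      rw [ENNReal.inv_mul_le_iff hc'0 hc']
      refine iSup₂_le fun x hx => ?_
      have hKx := hnec u' v' hu'm hv'm x hx _ fun f hf =>
        hardyNorm_le_of_holdsWith hp0 hq0 hθ h.w_weight.1 hC' hx hf
      rw [← hcongr u u' v v' hu' hv' x hx] at hKx
      calc (∫⁻ s in Ioi x, w s) ^ (-(1 / θ)) * K u v x
          ≤ (∫⁻ s in Ioi x, w s) ^ (-(1 / θ)) * (c' * (C * (∫⁻ s in Ioi x, w s) ^ (1 / θ))) := by
            gcongr
        _ = c' * C * ((∫⁻ s in Ioi x, w s) ^ (1 / θ) * (∫⁻ s in Ioi x, w s) ^ (-(1 / θ))) := by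
            ring
        _ = c' * C := by rw [hWmul x hx, mul_one]
    · rcases eq_or_ne A ∞ with hAt | hAt
      · rw [hAt, ENNReal.mul_top hκ0]
        exact le_top
      have hAK : ∀ x > 0, K u' v' x ≤ A * (∫⁻ s in Ioi x, w s) ^ (1 / θ) := fun x hx => by
        rw [← hcongr u u' v v' hu' hv' x hx]
        calc K u v x = (∫⁻ s in Ioi x, w s) ^ (-(1 / θ)) * K u v x *
              (∫⁻ s in Ioi x, w s) ^ (1 / θ) := by
              rw [mul_right_comm, mul_comm (_ ^ (-(1 / θ))), hWmul x hx, one_mul]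
          _ ≤ _ := by
              gcongr
              exact le_iSup₂_of_le x hx le_rfl
      -- a strictly larger constant is positive, so it also covers an infinite right-hand side
      refine le_of_forall_gt_imp_ge_of_dense fun D hD => ?_
      rcases eq_or_ne D ∞ with rfl | hDt
      · exact le_top
      lift D to ℝ≥0 using hDt
      refine iInf₂_le D ?_
      rintro f ⟨f', hf'm, hf'⟩
      have hFeq : ∀ t, ∫⁻ s in Ioo 0 t, f s = ∫⁻ s in Ioo 0 t, f' s := fun t =>
        setLIntegral_congr_of_ae_Ioi hf' Ioo_subset_Ioi_self
      have hces : cesaro p q u v f = cesaro p q u' v' f' := hardyNorm_congr le_rfl hu' hv' hf'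
      simp only [hFeq]
      rw [hces]
      by_cases hfin : ∀ t, ∫⁻ s in Ioo 0 t, f' s < ∞
      · refine (cesaro_le_of_hardy hθ hθp hpq hu'm hv'm h.w_weight.1 hf'm hfin
          (hsuff u' v' hu'm hv'm) hAK).trans ?_
        gcongr
      · push Not at hfin
        obtain ⟨t₀, ht₀⟩ := hfin
        have ht₀pos : 0 < t₀ := by
          by_contra hcon
          simp [Ioo_eq_empty hcon] at ht₀
        have hsub : Ioi t₀ ⊆ Ioi 0 := Ioi_subset_Ioi ht₀pos.le
        have hR : ∫⁻ t in Ioi (0 : ℝ), (∫⁻ s in Ioo 0 t, f' s) ^ θ * w t = ∞ := by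
          refine top_le_iff.1 ?_
          calc ∞ = ∞ * ∫⁻ t in Ioi t₀, w t := (ENNReal.top_mul (hW0 t₀ ht₀pos)).symm
            _ = ∫⁻ t in Ioi t₀, ∞ * w t := (lintegral_const_mul'' _
                (h.w_weight.1.mono_measure (Measure.restrict_mono hsub le_rfl))).symm
            _ ≤ ∫⁻ t in Ioi t₀, (∫⁻ s in Ioo 0 t, f' s) ^ θ * w t := by
                refine setLIntegral_mono' measurableSet_Ioi fun t ht => ?_
                have : ∫⁻ s in Ioo 0 t, f' s = ∞ := top_le_iff.1
                  (ht₀.trans (monotone_setLIntegral_Ioo f' 0 (le_of_lt ht)))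
                rw [this, ENNReal.top_rpow_of_pos hθ]
            _ ≤ _ := lintegral_mono_set hsub
        rw [hR, ENNReal.top_rpow_of_pos (by positivity), ENNReal.mul_top (pos_of_gt hD).ne']
        exact le_top
  constructor
  · intro u v w h
    obtain ⟨h1, h2⟩ := hbounds u v w h
    have hbest : (∃ C : ℝ≥0, HoldsWith p q θ u v w C) ↔ bestConstant p q θ u v w < ∞ := by
      simp [bestConstant, iInf_lt_iff]
    rw [hbest]
    constructor
    · intro hlt
      by_contra hcon
      rw [not_lt_top_iff.1 hcon, ENNReal.mul_top (ENNReal.inv_ne_zero.2 hc')] at h1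
      exact absurd hlt (not_lt.2 h1)
    · exact fun hlt => h2.trans_lt (ENNReal.mul_lt_top (lt_top_iff_ne_top.2 hκt) hlt)
  · refine ⟨c'⁻¹.toNNReal, κ.toNNReal, ?_, ?_, fun u v w h => ?_⟩
    · exact ENNReal.toNNReal_pos (ENNReal.inv_ne_zero.2 hc') (ENNReal.inv_ne_top.2 hc'0)
    · exact ENNReal.toNNReal_pos hκ0 hκt
    · rw [ENNReal.coe_toNNReal (ENNReal.inv_ne_top.2 hc'0), ENNReal.coe_toNNReal hκt]
      exact hbounds u v w h

end CesaroEmbedding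

theorem theorem1p1 (p q θ : ℝ) (hθ : 0 < θ) (hθp : θ ≤ p) (hp : p < min 1 q) :
    (1 ≤ q →
      (∀ u v w : ℝ → ℝ≥0∞, CesaroEmbedding.Admissible u v w →
        ((∃ C : ℝ≥0, CesaroEmbedding.HoldsWith p q θ u v w C) ↔
          CesaroEmbedding.A₁ p q θ u v w < ∞)) ∧
      ∃ c₁ c₂ : ℝ≥0, 0 < c₁ ∧ 0 < c₂ ∧
        ∀ u v w : ℝ → ℝ≥0∞, CesaroEmbedding.Admissible u v w →
          (c₁ : ℝ≥0∞) * CesaroEmbedding.A₁ p q θ u v w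
              ≤ CesaroEmbedding.bestConstant p q θ u v w ∧
            CesaroEmbedding.bestConstant p q θ u v w
              ≤ (c₂ : ℝ≥0∞) * CesaroEmbedding.A₁ p q θ u v w) ∧
    (q < 1 →
      (∀ u v w : ℝ → ℝ≥0∞, CesaroEmbedding.Admissible u v w →
        ((∃ C : ℝ≥0, CesaroEmbedding.HoldsWith p q θ u v w C) ↔
          CesaroEmbedding.A₂ p q θ u v w < ∞)) ∧
      ∃ c₁ c₂ : ℝ≥0, 0 < c₁ ∧ 0 < c₂ ∧
        ∀ u v w : ℝ → ℝ≥0∞, CesaroEmbedding.Admissible u v w →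
          (c₁ : ℝ≥0∞) * CesaroEmbedding.A₂ p q θ u v w
              ≤ CesaroEmbedding.bestConstant p q θ u v w ∧
            CesaroEmbedding.bestConstant p q θ u v w
              ≤ (c₂ : ℝ≥0∞) * CesaroEmbedding.A₂ p q θ u v w) := by
  have hp0 : 0 < p := by linarith
  have hp1 : p < 1 := hp.trans_le (min_le_left _ _)
  have hpq : p < q := hp.trans_le (min_le_right _ _)
  have hq0 : 0 < q := by linarith
  have hc0 : (2 * (4 : ℝ≥0∞) ^ (q / p)) ^ (1 / q) ≠ 0 :=
    (ENNReal.rpow_pos (ENNReal.mul_pos (by norm_num) (ENNReal.rpow_pos (by norm_num)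
      (by norm_num)).ne') (ENNReal.mul_ne_top (by norm_num)
      (ENNReal.rpow_ne_top_of_nonneg (by positivity) (by norm_num)))).ne'
  have hc : (2 * (4 : ℝ≥0∞) ^ (q / p)) ^ (1 / q) ≠ ∞ :=
    ENNReal.rpow_ne_top_of_nonneg (by positivity) (ENNReal.mul_ne_top (by norm_num)
      (ENNReal.rpow_ne_top_of_nonneg (by positivity) (by norm_num)))
  constructor
  · intro hq
    exact CesaroEmbedding.bestConstant_equiv hθ hθp hpq.le
      (K := CesaroEmbedding.hardyConst₁ p q) hc0 hc one_ne_zero ENNReal.one_ne_top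
      (fun u u' v v' hu hv x hx => CesaroEmbedding.hardyConst₁_congr (le_of_lt hx) hu hv)
      (fun u v hu hv x _ g hg hg1 =>
        CesaroEmbedding.hardyNorm_le_hardyConst₁ hg hu hv hp0 hp1 hq hg1)
      (fun u v _ hv x _ D hD => by
        rw [one_mul]
        exact CesaroEmbedding.hardyConst₁_le hv hp0 hp1 hq0 hD)
  · intro hq
    have h1p : 0 < 1 - p := by linarith
    have h1q : 0 < 1 - q := by linarith
    exact CesaroEmbedding.bestConstant_equiv hθ hθp hpq.le
      (K := CesaroEmbedding.hardyConst₂ p q) hc0 hc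
      (mul_ne_zero (ENNReal.rpow_pos (by norm_num) (by norm_num)).ne'
        (ENNReal.rpow_pos (by norm_num) (by norm_num)).ne')
      (ENNReal.mul_ne_top (ENNReal.rpow_ne_top_of_nonneg (by positivity) (by norm_num))
        (ENNReal.rpow_ne_top_of_nonneg (by positivity) (by norm_num)))
      (fun u u' v v' hu hv x hx => CesaroEmbedding.hardyConst₂_congr (le_of_lt hx) hu hv)
      (fun u v hu hv x _ g hg hg1 =>
        CesaroEmbedding.hardyNorm_le_hardyConst₂ hg hu hv hp0 hp1 hq0 hq hg1)
      (fun u v hu hv x _ D hD => CesaroEmbedding.hardyConst₂_le hu hv hp0 hpq hq hD)
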